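/- Let $l>0$ and let $\rho, I_w, EI, GJ, \eta_\omega, \eta_\phi \in L^\infty(0,l)$ be real-valued functions with strictly positive essential infima. Write $\overline{a}$ and $\underline{a}$ for the essential supremum and essential infimum of $a$ on $(0,l)$, and let $k_1,k_2\ge 0$. Let $$\mathcal{H}=\{(f,g,h,z)\in H^2(0,l)\times L^2(0,l)\times H^1(0,l)\times L^2(0,l) : f(0)=f'(0)=0,\ h(0)=0\}$$ (real-valued functions; point values are those of absolutely continuous representatives), with $$\langle X_1,X_2\rangle_{\mathcal{H},1}=\int_0^l \left[EI\, f_1''f_2''+\rho\, g_1g_2\right]\mathrm{d}y+\int_0^l \left[GJ\, h_1'h_2'+I_w\, z_1z_2\right]\mathrm{d}y$$ and, for $\epsilon_1,\epsilon_2>0$, $$\langle X_1,X_2\rangle_{\mathcal{H},2}=\langle X_1,X_2\rangle_{\mathcal{H},1}+\epsilon_1\int_0^l\rho\,[f_1g_2+g_1f_2]\,\mathrm{d}y+\epsilon_2\int_0^l I_w\,[h_1z_2+z_1h_2]\,\mathrm{d}y .$$ Define $$\mathcal{A}_1(f,g,h,z)=\left(g,\ -\tfrac1\rho (EI f''+\eta_\omega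 EI g'')'',\ z,\ \tfrac1{I_w}(GJ h'+\eta_\phi GJ z')'\right)$$ on the domain $D(\mathcal{A}_1)$ of all $(f,g,h,z)\in\mathcal{H}$ such that $g\in H^2(0,l)$, $z\in H^1(0,l)$, $EI f''+\eta_\omega EI g''\in H^2(0,l)$, $GJ h'+\eta_\phi GJ z'\in H^1(0,l)$, $g(0)=g'(0)=0$, $z(0)=0$, $(EI f''+\eta_\omega EI g'')(l)=0$, $(EI f''+\eta_\omega EI g'')'(l)=k_1(g(l)+\epsilon_1 f(l))$ and $(GJ h'+\eta_\phi GJ z')(l)=-k_2(z(l)+\epsilon_2 h(l))$. Put $$K_m=\max\left(\sqrt{\overline{\rho}},\ \frac{16 l^4\sqrt{\overline{\rho}}}{\pi^4\underline{EI}},\ \sqrt{\overline{I_w}},\ \frac{4l^2\sqrt{\overline{I_w}}}{\pi^2\underline{GJ}}\right),$$ $$\epsilon_1^*=\frac{4\pi^4\,\underline{\eta_\omega EI}}{64 l^4\overline{\rho}+\pi^4\overline{\eta_\omega}\,\underline{\eta_\omega EI}},\qquad \epsilon_2^*=\frac{4\pi^2\,\underline{\eta_\phi GJ}}{16 l^2\overline{I_w}+\pi^2\overline{\eta_\phi}\,\underline{\eta_\phi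 GJ}} .$$ Theorem. If $0<\epsilon_1<\min(\epsilon_1^*,1/K_m)$ and $0<\epsilon_2<\min(\epsilon_2^*,1/K_m)$, then $(\mathcal{H},\langle\cdot,\cdot\rangle_{\mathcal{H},1})$ and $(\mathcal{H},\langle\cdot,\cdot\rangle_{\mathcal{H},2})$ are real Hilbert spaces, the operator $\mathcal{A}_1$ generates a $C_0$-semigroup of contractions on $(\mathcal{H},\langle\cdot,\cdot\rangle_{\mathcal{H},2})$, and $D(\mathcal{A}_1)$ is dense in $\mathcal{H}$ endowed with either $\langle\cdot,\cdot\rangle_{\mathcal{H},1}$ or $\langle\cdot,\cdot\rangle_{\mathcal{H},2}$. -/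

import Mathlib

open MeasureTheory Set Filter Topology
open scoped NNReal

namespace FlexibleWing

noncomputable section

/-! ### Strongly continuous semigroups of contractions and their generators -/

section Semigroup

variable {E : Type*} [NormedAddCommGroup E] [NormedSpace ℝ E]

/-- A strongly continuous one-parameter semigroup of bounded operators, all of norm at most one. -/
structure IsC0ContractionSemigroup (T : ℝ≥0 → E →L[ℝ] E) : Prop where
  map_zero : T 0 = ContinuousLinearMap.id ℝ E
  map_add : ∀ s t : ℝ≥0, T (s + t) = (T s).comp (T t)
  tendsto_zero : ∀ x : E, Tendsto (fun t : ℝ≥0 => T t x) (𝓝[>] 0) (𝓝 x)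
  norm_le_one : ∀ t : ℝ≥0, ‖T t‖ ≤ 1

/-- `A` is the infinitesimal generator of `T`: its domain is exactly the set of those `x` at which
the right difference quotient of `T` at time zero converges, and `A x` is the limit. -/
def IsGenerator (A : E →ₗ.[ℝ] E) (T : ℝ≥0 → E →L[ℝ] E) : Prop :=
  ∀ x y : E, (∃ hx : x ∈ A.domain, A ⟨x, hx⟩ = y) ↔
    Tendsto (fun t : ℝ≥0 => (t : ℝ)⁻¹ • (T t x - x)) (𝓝[>] 0) (𝓝 y)

/-- `A` generates a strongly continuous semigroup of contractions. -/
def GeneratesC0Contractions (A : E →ₗ.[ℝ] E) : Prop :=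
  ∃ T : ℝ≥0 → E →L[ℝ] E, IsC0ContractionSemigroup T ∧ IsGenerator A T

end Semigroup

section InnerProduct

variable {V : Type*} [AddCommGroup V] [Module ℝ V]

/-- The vector space `V` with the inner product `c` is complete (a Hilbert space). -/
def IsHilbert (c : InnerProductSpace.Core ℝ V) : Prop :=
  letI : NormedAddCommGroup V := c.toNormedAddCommGroup
  CompleteSpace V

/-- `A` generates a strongly continuous semigroup of contractions on `V` with inner product `c`. -/
def GeneratesC0ContractionsOn (c : InnerProductSpace.Core ℝ V) (A : V →ₗ.[ℝ] V) : Prop :=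
  letI : NormedAddCommGroup V := c.toNormedAddCommGroup
  letI : InnerProductSpace ℝ V := InnerProductSpace.ofCore c.toCore
  GeneratesC0Contractions A

/-- `S` is dense in `V` for the norm induced by the inner product `c`. -/
def IsDenseIn (c : InnerProductSpace.Core ℝ V) (S : Set V) : Prop :=
  letI : NormedAddCommGroup V := c.toNormedAddCommGroup
  Dense S

end InnerProduct

/-! ### Sobolev spaces on an interval -/

/-- Lebesgue measure on the open interval `(0, l)`. -/
abbrev leb (l : ℝ) : Measure ℝ := volume.restrict (Ioo 0 l)

/-- The real space `L²(0, l)`. -/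
abbrev L2 (l : ℝ) : Type := Lp ℝ 2 (leb l)

/-- The real space `L^∞(0, l)`. -/
abbrev Linf (l : ℝ) : Type := Lp ℝ (⊤ : ENNReal) (leb l)

/-- The product of a function in `L^∞(0, l)` and a function in `L²(0, l)`. -/
def mulL {l : ℝ} (a : Linf l) (u : L2 l) : L2 l := a • u

/-- `v` is the weak derivative of `u` on `(0, l)`. -/
def IsWeakDeriv {l : ℝ} (u v : L2 l) : Prop :=
  ∀ φ : ℝ → ℝ, ContDiff ℝ (⊤ : ℕ∞) φ → HasCompactSupport φ → tsupport φ ⊆ Ioo 0 l →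
    ∫ y in Ioo 0 l, u y * deriv φ y = - ∫ y in Ioo 0 l, v y * φ y

open Classical in
/-- The weak derivative of `u`, if there is one in `L²(0, l)` (it is then unique), and `0`
otherwise. -/
def wd {l : ℝ} (u : L2 l) : L2 l :=
  if h : ∃ v, IsWeakDeriv u v then h.choose else 0

/-- `u` has an absolutely continuous representative on `[0, l]` whose value at `y` is `c`. -/
def HasValueAt {l : ℝ} (u : L2 l) (y c : ℝ) : Prop :=
  ∃ û : ℝ → ℝ, AbsolutelyContinuousOnInterval û 0 l ∧ u =ᵐ[leb l] û ∧ û y = c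

section Facts

variable {l : ℝ}

theorem integrable_mul_test (u : L2 l) {φ : ℝ → ℝ} (hφ : Continuous φ)
    (hs : HasCompactSupport φ) : Integrable (fun y => u y * φ y) (leb l) :=
  MemLp.integrable_mul (p := 2) (q := 2) (Lp.memLp u) (hφ.memLp_of_hasCompactSupport hs)

theorem IsWeakDeriv.add {u u' v v' : L2 l} (h : IsWeakDeriv u v) (h' : IsWeakDeriv u' v') :
    IsWeakDeriv (u + u') (v + v') := by
  intro φ hφ hc hs
  have hd : Continuous (deriv φ) := hφ.continuous_deriv (by norm_num)
  have e1 : ∫ y in Ioo 0 l, (u + u') y * deriv φ y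
      = ∫ y in Ioo 0 l, (u y * deriv φ y + u' y * deriv φ y) := by
    refine integral_congr_ae ?_
    filter_upwards [Lp.coeFn_add u u'] with y hy
    rw [hy, Pi.add_apply, add_mul]
  have e2 : ∫ y in Ioo 0 l, (v + v') y * φ y
      = ∫ y in Ioo 0 l, (v y * φ y + v' y * φ y) := by
    refine integral_congr_ae ?_
    filter_upwards [Lp.coeFn_add v v'] with y hy
    rw [hy, Pi.add_apply, add_mul]
  rw [e1, e2, integral_add (integrable_mul_test u hd hc.deriv)
    (integrable_mul_test u' hd hc.deriv), integral_add (integrable_mul_test v hφ.continuous hc)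
    (integrable_mul_test v' hφ.continuous hc), h φ hφ hc hs, h' φ hφ hc hs]
  ring

theorem IsWeakDeriv.smul (c : ℝ) {u v : L2 l} (h : IsWeakDeriv u v) :
    IsWeakDeriv (c • u) (c • v) := by
  intro φ hφ hc hs
  have e1 : ∫ y in Ioo 0 l, (c • u) y * deriv φ y
      = ∫ y in Ioo 0 l, c * (u y * deriv φ y) := by
    refine integral_congr_ae ?_
    filter_upwards [Lp.coeFn_smul c u] with y hy
    rw [hy, Pi.smul_apply, smul_eq_mul, mul_assoc]
  have e2 : ∫ y in Ioo 0 l, (c • v) y * φ y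
      = ∫ y in Ioo 0 l, c * (v y * φ y) := by
    refine integral_congr_ae ?_
    filter_upwards [Lp.coeFn_smul c v] with y hy
    rw [hy, Pi.smul_apply, smul_eq_mul, mul_assoc]
  rw [e1, e2, integral_const_mul, integral_const_mul, h φ hφ hc hs]
  ring

theorem IsWeakDeriv.zero : IsWeakDeriv (0 : L2 l) 0 := by
  have h : ∀ ψ : ℝ → ℝ, ∫ y in Ioo 0 l, (0 : L2 l) y * ψ y = 0 := by
    intro ψ
    rw [integral_eq_zero_of_ae]
    filter_upwards [Lp.coeFn_zero ℝ 2 (leb l)] with y hy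
    rw [hy]
    exact zero_mul _
  intro φ _ _ _
  rw [h, h, neg_zero]

theorem IsWeakDeriv.unique {u v v' : L2 l} (h : IsWeakDeriv u v) (h' : IsWeakDeriv u v') :
    v = v' := by
  have hloc : ∀ w : L2 l, LocallyIntegrableOn (fun y => w y) (Ioo 0 l) volume := fun w =>
    IntegrableOn.locallyIntegrableOn ((Lp.memLp w).integrable (by norm_num))
  have key := isOpen_Ioo.ae_eq_zero_of_integral_contDiff_smul_eq_zero (μ := volume)
    (f := fun y => v y - v' y) (U := Ioo 0 l) ((hloc v).sub (hloc v')) (by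
      intro φ hφ hc hs
      have hz : ∀ y, y ∉ Ioo 0 l → φ y • (v y - v' y) = 0 := fun y hy => by
        rw [image_eq_zero_of_notMem_tsupport (fun hh => hy (hs hh)), zero_smul]
      rw [← setIntegral_eq_integral_of_forall_compl_eq_zero hz]
      have e : ∫ y in Ioo 0 l, φ y • (v y - v' y)
          = ∫ y in Ioo 0 l, (v y * φ y - v' y * φ y) := by
        congr 1
        ext y
        simp only [smul_eq_mul]
        ring
      rw [e, integral_sub (integrable_mul_test v hφ.continuous hc)
        (integrable_mul_test v' hφ.continuous hc)]
      have h1 := h φ hφ hc hs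
      have h2 := h' φ hφ hc hs
      linarith)
  refine Lp.ext ((ae_restrict_iff' measurableSet_Ioo).2 ?_)
  filter_upwards [key] with y hy hm
  exact sub_eq_zero.1 (hy hm)

theorem IsWeakDeriv.wd_eq {u v : L2 l} (h : IsWeakDeriv u v) : wd u = v := by
  have hex : ∃ v, IsWeakDeriv u v := ⟨v, h⟩
  rw [wd, dif_pos hex]
  exact hex.choose_spec.unique h

theorem HasValueAt.add {u u' : L2 l} {y c c' : ℝ} (h : HasValueAt u y c)
    (h' : HasValueAt u' y c') : HasValueAt (u + u') y (c + c') := by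
  obtain ⟨w, hw, he, hy⟩ := h
  obtain ⟨w', hw', he', hy'⟩ := h'
  refine ⟨w + w', hw.add hw', ?_, by simp [hy, hy']⟩
  exact (Lp.coeFn_add u u').trans (he.add he')

theorem HasValueAt.smul (r : ℝ) {u : L2 l} {y c : ℝ} (h : HasValueAt u y c) :
    HasValueAt (r • u) y (r * c) := by
  obtain ⟨w, hw, he, hy⟩ := h
  refine ⟨fun x => r * w x, hw.const_mul r, ?_, by simp [hy]⟩
  filter_upwards [Lp.coeFn_smul r u, he] with x hx hx'
  rw [hx, Pi.smul_apply, smul_eq_mul, hx']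

theorem HasValueAt.zero (y : ℝ) : HasValueAt (0 : L2 l) y 0 :=
  ⟨fun _ => 0, ContDiffOn.absolutelyContinuousOnInterval contDiffOn_const,
    Lp.coeFn_zero ℝ 2 (leb l), rfl⟩

theorem HasValueAt.unique (hl : 0 < l) {u : L2 l} {y c c' : ℝ} (hy : y ∈ Icc 0 l)
    (h : HasValueAt u y c) (h' : HasValueAt u y c') : c = c' := by
  obtain ⟨w, hw, he, rfl⟩ := h
  obtain ⟨w', hw', he', rfl⟩ := h'
  have hc := hw.continuousOn
  have hc' := hw'.continuousOn
  rw [uIcc_of_le hl.le] at hc hc'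
  refine Measure.eqOn_Icc_of_ae_eq volume hl.ne ?_ hc hc' hy
  rw [← restrict_Ioo_eq_restrict_Icc]
  exact he.symm.trans he'

theorem mulL_add (a : Linf l) (u v : L2 l) : mulL a (u + v) = mulL a u + mulL a v :=
  Lp.add_smul a u v

theorem mulL_smul (a : Linf l) (c : ℝ) (u : L2 l) : mulL a (c • u) = c • mulL a u :=
  (Lp.smul_comm c a u).symm

end Facts

/-- The Sobolev space `H¹(0, l)`. -/
def H1 (l : ℝ) : Submodule ℝ (L2 l) where
  carrier := {u | ∃ v, IsWeakDeriv u v}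
  add_mem' := fun ⟨_, h⟩ ⟨_, h'⟩ => ⟨_, h.add h'⟩
  zero_mem' := ⟨0, IsWeakDeriv.zero⟩
  smul_mem' := fun c _ ⟨_, h⟩ => ⟨_, h.smul c⟩

theorem isWeakDeriv_wd {l : ℝ} {u : L2 l} (h : u ∈ H1 l) : IsWeakDeriv u (wd u) := by
  obtain ⟨v, hv⟩ := h
  rwa [hv.wd_eq]

theorem wd_add {l : ℝ} {u v : L2 l} (hu : u ∈ H1 l) (hv : v ∈ H1 l) :
    wd (u + v) = wd u + wd v :=
  ((isWeakDeriv_wd hu).add (isWeakDeriv_wd hv)).wd_eq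

theorem wd_smul {l : ℝ} (c : ℝ) {u : L2 l} (hu : u ∈ H1 l) : wd (c • u) = c • wd u :=
  ((isWeakDeriv_wd hu).smul c).wd_eq

theorem wd_zero {l : ℝ} : wd (0 : L2 l) = 0 := IsWeakDeriv.zero.wd_eq

/-- The Sobolev space `H²(0, l)`. -/
def H2 (l : ℝ) : Submodule ℝ (L2 l) where
  carrier := {u | u ∈ H1 l ∧ wd u ∈ H1 l}
  add_mem' := fun ⟨h, k⟩ ⟨h', k'⟩ =>
    ⟨add_mem h h', by rw [wd_add h h']; exact add_mem k k'⟩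
  zero_mem' := ⟨zero_mem _, by rw [wd_zero]; exact zero_mem _⟩
  smul_mem' := fun c _ ⟨h, k⟩ =>
    ⟨Submodule.smul_mem _ c h, by rw [wd_smul c h]; exact Submodule.smul_mem _ c k⟩

theorem wd2_add {l : ℝ} {u v : L2 l} (hu : u ∈ H2 l) (hv : v ∈ H2 l) :
    wd (wd (u + v)) = wd (wd u) + wd (wd v) := by
  rw [wd_add hu.1 hv.1, wd_add hu.2 hv.2]

theorem wd2_smul {l : ℝ} (c : ℝ) {u : L2 l} (hu : u ∈ H2 l) :
    wd (wd (c • u)) = c • wd (wd u) := by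
  rw [wd_smul c hu.1, wd_smul c hu.2]

/-! ### The wing -/

/-- The physical parameters of the wing and the two feedback gains. -/
structure Wing where
  /-- length -/
  l : ℝ
  l_pos : 0 < l
  /-- mass per unit of span -/
  ρ : Linf l
  /-- moment of inertia per unit of span -/
  Iw : Linf l
  /-- bending stiffness -/
  EI : Linf l
  /-- torsional stiffness -/
  GJ : Linf l
  /-- bending Kelvin-Voigt damping coefficient -/
  ηω : Linf l
  /-- torsional Kelvin-Voigt damping coefficient -/
  ηφ : Linf l
  ρ_pos : 0 < essInf ρ (leb l)
  Iw_pos : 0 < essInf Iw (leb l)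
  EI_pos : 0 < essInf EI (leb l)
  GJ_pos : 0 < essInf GJ (leb l)
  ηω_pos : 0 < essInf ηω (leb l)
  ηφ_pos : 0 < essInf ηφ (leb l)
  /-- gain of the bending feedback -/
  k₁ : ℝ
  /-- gain of the torsional feedback -/
  k₂ : ℝ
  k₁_nonneg : 0 ≤ k₁
  k₂_nonneg : 0 ≤ k₂

/-- An essentially bounded function with positive essential infimum has an essentially bounded
reciprocal. -/
theorem memLp_inv {l : ℝ} (a : Linf l) (ha : 0 < essInf a (leb l)) :
    MemLp (fun y => (a y)⁻¹) (⊤ : ENNReal) (leb l) := by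
  have hb : IsBoundedUnder (· ≥ ·) (ae (leb l)) a := by
    by_contra hn
    have : essInf a (leb l) = 0 := by
      rw [essInf, liminf_eq]
      have : {c | ∀ᶠ y in ae (leb l), c ≤ a y} = ∅ := by
        ext c
        simp only [Set.mem_ofPred_eq, mem_empty_iff_false, iff_false]
        exact fun hc => hn ⟨c, hc⟩
      rw [this, Real.sSup_empty]
    exact ha.ne' this
  have hle : ∀ᵐ y ∂(leb l), essInf a (leb l) ≤ a y := ae_essInf_le hb
  refine memLp_top_of_bound (Lp.aestronglyMeasurable a).aemeasurable.inv.aestronglyMeasurable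
    (essInf a (leb l))⁻¹ ?_
  filter_upwards [hle] with y hy
  rw [Real.norm_eq_abs, abs_inv, abs_of_pos (ha.trans_le hy)]
  exact inv_anti₀ ha hy

/-- The reciprocal in `L^∞(0, l)` of a function with positive essential infimum. -/
def recip {l : ℝ} (a : Linf l) (ha : 0 < essInf a (leb l)) : Linf l :=
  (memLp_inv a ha).toLp _

namespace Wing

variable (P : Wing)

/-- The space of states `(f, g, h, z)` as a subspace of `L² × L² × L² × L²`:
`f ∈ H²` with `f(0) = f'(0) = 0`, `g ∈ L²`, `h ∈ H¹` with `h(0) = 0`, `z ∈ L²`. -/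
def stateSubmodule : Submodule ℝ (L2 P.l × L2 P.l × L2 P.l × L2 P.l) where
  carrier := {X | X.1 ∈ H2 P.l ∧ X.2.2.1 ∈ H1 P.l ∧ HasValueAt X.1 0 0 ∧
    HasValueAt (wd X.1) 0 0 ∧ HasValueAt X.2.2.1 0 0}
  add_mem' := by
    rintro X Y ⟨a1, a2, a3, a4, a5⟩ ⟨b1, b2, b3, b4, b5⟩
    refine ⟨add_mem a1 b1, add_mem a2 b2, by simpa using a3.add b3, ?_, by simpa using a5.add b5⟩
    rw [Prod.fst_add, wd_add a1.1 b1.1]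
    simpa using a4.add b4
  zero_mem' := ⟨zero_mem _, zero_mem _, HasValueAt.zero 0,
    by rw [Prod.fst_zero, wd_zero]; exact HasValueAt.zero 0, HasValueAt.zero 0⟩
  smul_mem' := by
    rintro c X ⟨a1, a2, a3, a4, a5⟩
    refine ⟨Submodule.smul_mem _ c a1, Submodule.smul_mem _ c a2, by simpa using a3.smul c, ?_,
      by simpa using a5.smul c⟩
    rw [Prod.smul_fst, wd_smul c a1.1]
    simpa using a4.smul c

/-- The real vector space of states. It is a type of its own, so that the only norms on it are the
ones given explicitly by an inner product. -/
def State : Type := ↥P.stateSubmodule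

instance : AddCommGroup P.State := inferInstanceAs (AddCommGroup ↥P.stateSubmodule)

instance : Module ℝ P.State := inferInstanceAs (Module ℝ ↥P.stateSubmodule)

variable {P}

namespace State

/-- bending displacement -/
def f (X : P.State) : L2 P.l := X.1.1

/-- bending velocity -/
def g (X : P.State) : L2 P.l := X.1.2.1

/-- twisting displacement -/
def h (X : P.State) : L2 P.l := X.1.2.2.1

/-- twisting velocity -/
def z (X : P.State) : L2 P.l := X.1.2.2.2

theorem f_mem (X : P.State) : X.f ∈ H2 P.l := X.2.1

theorem h_mem (X : P.State) : X.h ∈ H1 P.l := X.2.2.1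

theorem f_add (X Y : P.State) : (X + Y).f = X.f + Y.f := rfl
theorem g_add (X Y : P.State) : (X + Y).g = X.g + Y.g := rfl
theorem h_add (X Y : P.State) : (X + Y).h = X.h + Y.h := rfl
theorem z_add (X Y : P.State) : (X + Y).z = X.z + Y.z := rfl
theorem f_smul (c : ℝ) (X : P.State) : (c • X).f = c • X.f := rfl
theorem g_smul (c : ℝ) (X : P.State) : (c • X).g = c • X.g := rfl
theorem h_smul (c : ℝ) (X : P.State) : (c • X).h = c • X.h := rfl
theorem z_smul (c : ℝ) (X : P.State) : (c • X).z = c • X.z := rfl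
theorem f_zero : (0 : P.State).f = 0 := rfl
theorem g_zero : (0 : P.State).g = 0 := rfl
theorem h_zero : (0 : P.State).h = 0 := rfl
theorem z_zero : (0 : P.State).z = 0 := rfl

theorem ext {X Y : P.State} (hf : X.f = Y.f) (hg : X.g = Y.g) (hh : X.h = Y.h)
    (hz : X.z = Y.z) : X = Y :=
  Subtype.ext (Prod.ext hf (Prod.ext hg (Prod.ext hh hz)))

end State

/-- `⟨X, Y⟩₁ = ∫ (EI f₁'' f₂'' + ρ g₁ g₂) + ∫ (GJ h₁' h₂' + I_w z₁ z₂)` -/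
def inner₁ (X Y : P.State) : ℝ :=
  (∫ y in Ioo 0 P.l, (P.EI y * wd (wd X.f) y * wd (wd Y.f) y + P.ρ y * X.g y * Y.g y)) +
  ∫ y in Ioo 0 P.l, (P.GJ y * wd X.h y * wd Y.h y + P.Iw y * X.z y * Y.z y)

/-- `⟨X, Y⟩₂ = ⟨X, Y⟩₁ + ε₁ ∫ ρ (f₁ g₂ + g₁ f₂) + ε₂ ∫ I_w (h₁ z₂ + z₁ h₂)` -/
def inner₂ (ε₁ ε₂ : ℝ) (X Y : P.State) : ℝ :=
  inner₁ X Y + ε₁ * (∫ y in Ioo 0 P.l, P.ρ y * (X.f y * Y.g y + X.g y * Y.f y)) +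
  ε₂ * ∫ y in Ioo 0 P.l, P.Iw y * (X.h y * Y.z y + X.z y * Y.h y)

/-- The bending moment `EI f'' + η_ω EI g''` (meaningful when `g ∈ H²`). -/
def bendingMoment (X : P.State) : L2 P.l :=
  mulL P.EI (wd (wd X.f)) + mulL P.ηω (mulL P.EI (wd (wd X.g)))

/-- The torsional moment `GJ h' + η_φ GJ z'` (meaningful when `z ∈ H¹`). -/
def torsionMoment (X : P.State) : L2 P.l :=
  mulL P.GJ (wd X.h) + mulL P.ηφ (mulL P.GJ (wd X.z))

/-- Membership in the domain of the operator: regularity, clamped root, vanishing bending moment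
at the tip, and the two feedback conditions at the tip,
`(EI f'' + η_ω EI g'')'(l) = k₁ (g(l) + ε₁ f(l))` and
`(GJ h' + η_φ GJ z')(l) = - k₂ (z(l) + ε₂ h(l))`. -/
structure InDomain (ε₁ ε₂ : ℝ) (X : P.State) : Prop where
  g_mem : X.g ∈ H2 P.l
  z_mem : X.z ∈ H1 P.l
  bending_mem : bendingMoment X ∈ H2 P.l
  torsion_mem : torsionMoment X ∈ H1 P.l
  g_root : HasValueAt X.g 0 0
  dg_root : HasValueAt (wd X.g) 0 0
  z_root : HasValueAt X.z 0 0
  bending_tip : HasValueAt (bendingMoment X) P.l 0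
  bending_feedback : ∃ fl gl : ℝ, HasValueAt X.f P.l fl ∧ HasValueAt X.g P.l gl ∧
    HasValueAt (wd (bendingMoment X)) P.l (P.k₁ * (gl + ε₁ * fl))
  torsion_feedback : ∃ hl zl : ℝ, HasValueAt X.h P.l hl ∧ HasValueAt X.z P.l zl ∧
    HasValueAt (torsionMoment X) P.l (-(P.k₂ * (zl + ε₂ * hl)))

theorem bendingMoment_add {X Y : P.State} (hX : X.g ∈ H2 P.l) (hY : Y.g ∈ H2 P.l) :
    bendingMoment (X + Y) = bendingMoment X + bendingMoment Y := by
  simp only [bendingMoment, State.f_add, State.g_add, wd2_add X.f_mem Y.f_mem, wd2_add hX hY,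
    mulL_add]
  abel

theorem bendingMoment_smul (c : ℝ) {X : P.State} (hX : X.g ∈ H2 P.l) :
    bendingMoment (c • X) = c • bendingMoment X := by
  simp only [bendingMoment, State.f_smul, State.g_smul, wd2_smul c X.f_mem, wd2_smul c hX,
    mulL_smul, smul_add]

theorem torsionMoment_add {X Y : P.State} (hX : X.z ∈ H1 P.l) (hY : Y.z ∈ H1 P.l) :
    torsionMoment (X + Y) = torsionMoment X + torsionMoment Y := by
  simp only [torsionMoment, State.h_add, State.z_add, wd_add X.h_mem Y.h_mem, wd_add hX hY,
    mulL_add]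
  abel

theorem torsionMoment_smul (c : ℝ) {X : P.State} (hX : X.z ∈ H1 P.l) :
    torsionMoment (c • X) = c • torsionMoment X := by
  simp only [torsionMoment, State.h_smul, State.z_smul, wd_smul c X.h_mem, wd_smul c hX,
    mulL_smul, smul_add]

theorem InDomain.add {ε₁ ε₂ : ℝ} {X Y : P.State} (hX : InDomain ε₁ ε₂ X)
    (hY : InDomain ε₁ ε₂ Y) : InDomain ε₁ ε₂ (X + Y) where
  g_mem := add_mem hX.g_mem hY.g_mem
  z_mem := add_mem hX.z_mem hY.z_mem
  bending_mem := by
    rw [bendingMoment_add hX.g_mem hY.g_mem]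
    exact add_mem hX.bending_mem hY.bending_mem
  torsion_mem := by
    rw [torsionMoment_add hX.z_mem hY.z_mem]
    exact add_mem hX.torsion_mem hY.torsion_mem
  g_root := by simpa [State.g_add] using hX.g_root.add hY.g_root
  dg_root := by
    rw [State.g_add, wd_add hX.g_mem.1 hY.g_mem.1]
    simpa using hX.dg_root.add hY.dg_root
  z_root := by simpa [State.z_add] using hX.z_root.add hY.z_root
  bending_tip := by
    rw [bendingMoment_add hX.g_mem hY.g_mem]
    simpa using hX.bending_tip.add hY.bending_tip
  bending_feedback := by
    obtain ⟨a, b, h1, h2, h3⟩ := hX.bending_feedback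
    obtain ⟨a', b', h1', h2', h3'⟩ := hY.bending_feedback
    refine ⟨a + a', b + b', h1.add h1', h2.add h2', ?_⟩
    rw [bendingMoment_add hX.g_mem hY.g_mem, wd_add hX.bending_mem.1 hY.bending_mem.1]
    convert h3.add h3' using 1
    ring
  torsion_feedback := by
    obtain ⟨a, b, h1, h2, h3⟩ := hX.torsion_feedback
    obtain ⟨a', b', h1', h2', h3'⟩ := hY.torsion_feedback
    refine ⟨a + a', b + b', h1.add h1', h2.add h2', ?_⟩
    rw [torsionMoment_add hX.z_mem hY.z_mem]
    convert h3.add h3' using 1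
    ring

theorem InDomain.smul {ε₁ ε₂ : ℝ} (c : ℝ) {X : P.State} (hX : InDomain ε₁ ε₂ X) :
    InDomain ε₁ ε₂ (c • X) where
  g_mem := Submodule.smul_mem _ c hX.g_mem
  z_mem := Submodule.smul_mem _ c hX.z_mem
  bending_mem := by
    rw [bendingMoment_smul c hX.g_mem]
    exact Submodule.smul_mem _ c hX.bending_mem
  torsion_mem := by
    rw [torsionMoment_smul c hX.z_mem]
    exact Submodule.smul_mem _ c hX.torsion_mem
  g_root := by simpa [State.g_smul] using hX.g_root.smul c
  dg_root := by
    rw [State.g_smul, wd_smul c hX.g_mem.1]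
    simpa using hX.dg_root.smul c
  z_root := by simpa [State.z_smul] using hX.z_root.smul c
  bending_tip := by
    rw [bendingMoment_smul c hX.g_mem]
    simpa using hX.bending_tip.smul c
  bending_feedback := by
    obtain ⟨a, b, h1, h2, h3⟩ := hX.bending_feedback
    refine ⟨c * a, c * b, h1.smul c, h2.smul c, ?_⟩
    rw [bendingMoment_smul c hX.g_mem, wd_smul c hX.bending_mem.1]
    convert h3.smul c using 1
    ring
  torsion_feedback := by
    obtain ⟨a, b, h1, h2, h3⟩ := hX.torsion_feedback
    refine ⟨c * a, c * b, h1.smul c, h2.smul c, ?_⟩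
    rw [torsionMoment_smul c hX.z_mem]
    convert h3.smul c using 1
    ring

theorem InDomain.zero (ε₁ ε₂ : ℝ) : InDomain ε₁ ε₂ (0 : P.State) := by
  have hb : bendingMoment (0 : P.State) = 0 := by
    have := bendingMoment_smul (0 : ℝ) (X := (0 : P.State)) (zero_mem (H2 P.l))
    simpa using this
  have ht : torsionMoment (0 : P.State) = 0 := by
    have := torsionMoment_smul (0 : ℝ) (X := (0 : P.State)) (zero_mem (H1 P.l))
    simpa using this
  refine ⟨zero_mem _, zero_mem _, by rw [hb]; exact zero_mem _, by rw [ht]; exact zero_mem _,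
    HasValueAt.zero 0, ?_, HasValueAt.zero 0, by rw [hb]; exact HasValueAt.zero _,
    ⟨0, 0, HasValueAt.zero _, HasValueAt.zero _, ?_⟩,
    ⟨0, 0, HasValueAt.zero _, HasValueAt.zero _, ?_⟩⟩
  · rw [State.g_zero, wd_zero]
    exact HasValueAt.zero 0
  · rw [hb, wd_zero]
    simpa using HasValueAt.zero (l := P.l) P.l
  · rw [ht]
    simpa using HasValueAt.zero (l := P.l) P.l

variable (P)

/-- The domain of the operator as a subspace of the space of states. -/
def domain (ε₁ ε₂ : ℝ) : Submodule ℝ P.State where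
  carrier := {X | InDomain ε₁ ε₂ X}
  add_mem' := fun hX hY => hX.add hY
  zero_mem' := InDomain.zero ε₁ ε₂
  smul_mem' := fun c _ hX => hX.smul c

/-- The operator
`A₁ (f, g, h, z) = (g, -(1/ρ) (EI f'' + η_ω EI g'')'', z, (1/I_w) (GJ h' + η_φ GJ z')')`. -/
def A₁ (ε₁ ε₂ : ℝ) : P.State →ₗ.[ℝ] P.State where
  domain := P.domain ε₁ ε₂
  toFun :=
    { toFun := fun X =>
        ⟨(X.1.g, -mulL (recip P.ρ P.ρ_pos) (wd (wd (bendingMoment X.1))), X.1.z,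
          mulL (recip P.Iw P.Iw_pos) (wd (torsionMoment X.1))),
          X.2.g_mem, X.2.z_mem, X.2.g_root, X.2.dg_root, X.2.z_root⟩
      map_add' := fun X Y => by
        refine State.ext rfl ?_ rfl ?_
        · change -mulL _ (wd (wd (bendingMoment (X.1 + Y.1))))
            = -mulL _ (wd (wd (bendingMoment X.1))) + -mulL _ (wd (wd (bendingMoment Y.1)))
          rw [bendingMoment_add X.2.g_mem Y.2.g_mem, wd2_add X.2.bending_mem Y.2.bending_mem,
            mulL_add, neg_add]
        · change mulL _ (wd (torsionMoment (X.1 + Y.1)))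
            = mulL _ (wd (torsionMoment X.1)) + mulL _ (wd (torsionMoment Y.1))
          rw [torsionMoment_add X.2.z_mem Y.2.z_mem, wd_add X.2.torsion_mem Y.2.torsion_mem,
            mulL_add]
      map_smul' := fun c X => by
        refine State.ext rfl ?_ rfl ?_
        · change -mulL _ (wd (wd (bendingMoment (c • X.1))))
            = c • -mulL _ (wd (wd (bendingMoment X.1)))
          rw [bendingMoment_smul c X.2.g_mem, wd2_smul c X.2.bending_mem, mulL_smul, smul_neg]
        · change mulL _ (wd (torsionMoment (c • X.1))) = c • mulL _ (wd (torsionMoment X.1))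
          rw [torsionMoment_smul c X.2.z_mem, wd_smul c X.2.torsion_mem, mulL_smul] }

/-- `K_m = max (√ρ̄, 16 l⁴ √ρ̄ / (π⁴ EI̲), √I̅_w, 4 l² √I̅_w / (π² GJ̲))`, where bars denote essential
suprema (above) and infima (below). -/
def Km : ℝ :=
  max (max √(essSup P.ρ (leb P.l))
      (16 * P.l ^ 4 * √(essSup P.ρ (leb P.l)) / (Real.pi ^ 4 * essInf P.EI (leb P.l))))
    (max √(essSup P.Iw (leb P.l))
      (4 * P.l ^ 2 * √(essSup P.Iw (leb P.l)) / (Real.pi ^ 2 * essInf P.GJ (leb P.l))))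

/-- The essential infimum of the product `η_ω EI`. -/
def infηEI : ℝ := essInf (fun y => P.ηω y * P.EI y) (leb P.l)

/-- The essential infimum of the product `η_φ GJ`. -/
def infηGJ : ℝ := essInf (fun y => P.ηφ y * P.GJ y) (leb P.l)

/-- The bound `ε₁*`. -/
def ε₁star : ℝ :=
  4 * Real.pi ^ 4 * P.infηEI /
    (64 * P.l ^ 4 * essSup P.ρ (leb P.l) +
      Real.pi ^ 4 * essSup P.ηω (leb P.l) * P.infηEI)

/-- The bound `ε₂*`. -/
def ε₂star : ℝ :=
  4 * Real.pi ^ 2 * P.infηGJ /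
    (16 * P.l ^ 2 * essSup P.Iw (leb P.l) +
      Real.pi ^ 2 * essSup P.ηφ (leb P.l) * P.infηGJ)

end Wing

end

end FlexibleWing

namespace FlexibleWing

noncomputable section

/-! ### The Lumer–Phillips theorem in a Hilbert space -/

section LumerPhillips

open scoped RealInnerProductSpace

variable {E : Type*} [NormedAddCommGroup E] [InnerProductSpace ℝ E] [CompleteSpace E]

/-! Integrating from the clamped root turns everything into bounded operators. Let V be the Volterra
operator w ↦ ∫₀ʸ w on L²(0,l). A state amounts to four free L² functions: the curvature w = f'', g,
the twist rate v = h', and z, with f = V²w and h = Vv (`State.equivL2`). The coefficients are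
bounded above and away from zero, so in these coordinates the energy form is equivalent to the L²
norm, whence completeness. The sharp Poincaré inequality ‖Vw‖ ≤ (2l/π)‖w‖ bounds the cross terms of
the second form by `Km` times the energy, so ε₁ Km, ε₂ Km < 1 makes the two forms equivalent.

Bending and torsion decouple and share one shape. Let p be g'' or z', K be V² or V, and G be the
second derivative of the bending moment or minus the derivative of the torsional moment. Let e
represent the tip value, ⟨e, u⟩ = (Ku)(l). Since V* integrates from the tip, the tip conditions
amount to one identity in L²: E w + η E p = K*G − k⟨e, p + εw⟩e (`InDomain.bendingMoment_eq`,
`InDomain.torsionMoment_eq`, and conversely `inDomain_mk'`).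

Dissipativity: pair this identity with p + εw. The feedback contributes −k⟨e, p + εw⟩², the elastic
terms of order zero in ε cancel, and what is left is ε times a kinetic term minus the Kelvin–Voigt
dissipation. Completing a square (`damping_estimate`) and using Poincaré again makes this
nonpositive for ε below its starred bound (`dissipation_estimate`).

Range: eliminating w and the velocities from (s − A)X = Y leaves a bounded equation for p, coercive
because of the damping, so Lax–Milgram applies (`exists_resolvent_solution`). The Lumer–Phillips
theorem, obtained through Yosida approximation (`generates_of_dissipative`), gives the semigroup.
Density of the domain is automatic for such operators on a Hilbert space, and equivalence of the
norms carries it to the energy norm. -/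

theorem hasDerivAt_exp_smul_apply (B : E →L[ℝ] E) (x : E) (t : ℝ) :
    HasDerivAt (fun s : ℝ => NormedSpace.exp (s • B) x) (B (NormedSpace.exp (t • B) x)) t :=
  ((ContinuousLinearMap.apply ℝ E x).hasFDerivAt.comp_hasDerivAt t
    (hasDerivAt_exp_smul_const' (𝕂 := ℝ) B t))

theorem exp_add_smul_apply (B : E →L[ℝ] E) (x : E) (s t : ℝ) :
    NormedSpace.exp ((s + t) • B) x = NormedSpace.exp (s • B) (NormedSpace.exp (t • B) x) := by
  have h : Commute (s • B) (t • B) := ((Commute.refl B).smul_left s).smul_right t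
  rw [add_smul, NormedSpace.exp_add_of_commute_of_mem_ball (𝕂 := ℝ) h]
  · rfl
  all_goals simp [NormedSpace.expSeries_radius_eq_top]

/-- The squared norm of the orbit has derivative 2⟪x(s), B x(s)⟫ ≤ 0. -/
theorem norm_exp_smul_apply_le {B : E →L[ℝ] E} (hB : ∀ x, ⟪B x, x⟫ ≤ 0) {t : ℝ} (ht : 0 ≤ t)
    (x : E) : ‖NormedSpace.exp (t • B) x‖ ≤ ‖x‖ := by
  have hd : ∀ s : ℝ, HasDerivAt (fun s : ℝ => ‖NormedSpace.exp (s • B) x‖ ^ 2)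
      (2 * ⟪NormedSpace.exp (s • B) x, B (NormedSpace.exp (s • B) x)⟫) s := fun s =>
    (hasDerivAt_exp_smul_apply B x s).norm_sq
  have hanti := antitone_of_hasDerivAt_nonpos hd (fun s => by
    rw [Pi.zero_apply, real_inner_comm]
    linarith [hB (NormedSpace.exp (s • B) x)])
  have := hanti ht
  simp only [zero_smul, NormedSpace.exp_zero, one_apply_eq_self] at this
  exact (pow_le_pow_iff_left₀ (norm_nonneg _) (norm_nonneg _) two_ne_zero).1 this

omit [CompleteSpace E] in
theorem commute_exp_smul_apply {B C : E →L[ℝ] E} (h : Commute B C) (t : ℝ) (x : E) :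
    B (NormedSpace.exp (t • C) x) = NormedSpace.exp (t • C) (B x) := by
  have h1 : Commute B (NormedSpace.exp (t • C)) := (h.smul_right t).exp_right
  exact DFunLike.congr_fun h1.eq x

theorem norm_exp_smul_apply_sub_self_le {B : E →L[ℝ] E} (hB : ∀ x, ⟪B x, x⟫ ≤ 0) {t : ℝ}
    (ht : 0 ≤ t) (x : E) : ‖NormedSpace.exp (t • B) x - x‖ ≤ t * ‖B x‖ := by
  have := norm_image_sub_le_of_norm_deriv_le_segment' (a := 0) (b := t) (C := ‖B x‖)
    (fun s _ => (hasDerivAt_exp_smul_apply B x s).hasDerivWithinAt) (fun s hs => by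
      rw [commute_exp_smul_apply (Commute.refl B)]
      exact norm_exp_smul_apply_le hB hs.1 _) t ⟨ht, le_rfl⟩
  simpa [NormedSpace.exp_zero, mul_comm] using this

/-- The path s ↦ exp(sB) exp((t − s)C) x joins the two vectors. By commutation its derivative is
exp(sB) exp((t − s)C)(Bx − Cx), of norm at most ‖Bx − Cx‖. This yields the Cauchy property of the
approximating semigroups. -/
theorem norm_exp_smul_apply_sub_le {B C : E →L[ℝ] E} (hB : ∀ x, ⟪B x, x⟫ ≤ 0)
    (hC : ∀ x, ⟪C x, x⟫ ≤ 0) (hBC : Commute B C) {t : ℝ} (ht : 0 ≤ t) (x : E) :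
    ‖NormedSpace.exp (t • B) x - NormedSpace.exp (t • C) x‖ ≤ t * ‖B x - C x‖ := by
  have key : ∀ s : ℝ, HasDerivAt
      (fun s : ℝ => NormedSpace.exp (s • B) (NormedSpace.exp ((t - s) • C) x))
      (NormedSpace.exp (s • B) (NormedSpace.exp ((t - s) • C) (B x - C x))) s := by
    intro s
    have h1 : HasDerivAt (fun s : ℝ => NormedSpace.exp (s • B))
      (B * NormedSpace.exp (s • B)) s := hasDerivAt_exp_smul_const' (𝕂 := ℝ) B s
    have h2 : HasDerivAt (fun s : ℝ => NormedSpace.exp ((t - s) • C) x)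
        ((-1 : ℝ) • C (NormedSpace.exp ((t - s) • C) x)) s :=
      (hasDerivAt_exp_smul_apply C x (t - s)).scomp s ((hasDerivAt_id s).const_sub t)
    convert! h1.clm_apply h2 using 1
    rw [mul_apply_eq_comp, commute_exp_smul_apply (Commute.refl B),
      commute_exp_smul_apply hBC, commute_exp_smul_apply (Commute.refl C), map_smul,
      map_sub, map_sub, neg_one_smul, sub_eq_add_neg]
  have := norm_image_sub_le_of_norm_deriv_le_segment' (a := 0) (b := t) (C := ‖B x - C x‖)
    (fun s _ => (key s).hasDerivWithinAt) (fun s hs =>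
      (norm_exp_smul_apply_le hB hs.1 _).trans
        (norm_exp_smul_apply_le hC (sub_nonneg.2 hs.2.le) _)) t ⟨ht, le_rfl⟩
  simpa [NormedSpace.exp_zero, mul_comm] using this

/-- A Taylor bound through B²x would not be uniform along the approximations, since the limit of Bx
need not lie in the domain. The auxiliary vector u, later taken in the domain close to that limit,
replaces Bx at the cost of 2‖Bx − u‖, and only Bu enters the second-order term. -/
theorem norm_exp_smul_apply_sub_sub_le {B : E →L[ℝ] E} (hB : ∀ x, ⟪B x, x⟫ ≤ 0) {t : ℝ}
    (ht : 0 ≤ t) (x u : E) :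
    ‖NormedSpace.exp (t • B) x - x - t • B x‖ ≤ t * (2 * ‖B x - u‖ + t * ‖B u‖) := by
  have hd : ∀ s : ℝ, HasDerivAt (fun s : ℝ => NormedSpace.exp (s • B) x - s • B x)
      (NormedSpace.exp (s • B) (B x) - B x) s := fun s => by
    rw [← commute_exp_smul_apply (Commute.refl B)]
    exact ((hasDerivAt_exp_smul_apply B x s).sub
      ((hasDerivAt_id s).smul_const (B x))).congr_deriv (by simp)
  have := norm_image_sub_le_of_norm_deriv_le_segment' (a := 0) (b := t)
    (C := 2 * ‖B x - u‖ + t * ‖B u‖)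
    (fun s _ => (hd s).hasDerivWithinAt) (fun s hs => by
      have e : NormedSpace.exp (s • B) (B x) - B x = NormedSpace.exp (s • B) (B x - u)
          + (NormedSpace.exp (s • B) u - u) - (B x - u) := by
        rw [map_sub]; abel
      rw [e]
      have h1 := norm_exp_smul_apply_le hB hs.1 (B x - u)
      have h2 := norm_exp_smul_apply_sub_self_le hB hs.1 u
      have h3 : s * ‖B u‖ ≤ t * ‖B u‖ := by
        gcongr
        exact hs.2.le
      have h4 := norm_sub_le (NormedSpace.exp (s • B) (B x - u)
          + (NormedSpace.exp (s • B) u - u)) (B x - u)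
      have h5 := norm_add_le (NormedSpace.exp (s • B) (B x - u))
          (NormedSpace.exp (s • B) u - u)
      linarith) t ⟨ht, le_rfl⟩
  have e : NormedSpace.exp (t • B) x - x - t • B x = NormedSpace.exp (t • B) x - t • B x - x := by
    abel
  rw [e]
  simpa [NormedSpace.exp_zero, mul_comm] using this

/-! ### Passage to the limit in the approximating semigroups -/

/-- Convergence of a uniformly contractive sequence of operators on a dense set implies
convergence everywhere. -/
theorem exists_tendsto_of_dense {S : ℕ → E →L[ℝ] E} (hS : ∀ n x, ‖S n x‖ ≤ ‖x‖) {D : Set E}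
    (hD : Dense D) (hc : ∀ x ∈ D, CauchySeq fun n => S n x) (x : E) :
    ∃ y, Tendsto (fun n => S n x) atTop (𝓝 y) := by
  refine cauchySeq_tendsto_of_complete (Metric.cauchySeq_iff.2 fun ε hε => ?_)
  obtain ⟨x', hx', hxx⟩ := hD.exists_dist_lt x (show 0 < ε / 3 by positivity)
  obtain ⟨N, hN⟩ := Metric.cauchySeq_iff.1 (hc x' hx') (ε / 3) (by positivity)
  refine ⟨N, fun m hm n hn => ?_⟩
  have h1 := hN m hm n hn
  rw [dist_eq_norm] at h1 hxx ⊢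
  have e : S m x - S n x = S m (x - x') + (S m x' - S n x') - S n (x - x') := by
    simp only [map_sub]; abel
  rw [e]
  have h2 := hS m (x - x')
  have h3 := hS n (x - x')
  have h4 := norm_sub_le (S m (x - x') + (S m x' - S n x')) (S n (x - x'))
  have h5 := norm_add_le (S m (x - x')) (S m x' - S n x')
  linarith

/-- A semigroup of contractions obtained from bounded dissipative approximations of its
generator. -/
theorem generates_of_approximation {A : E →ₗ.[ℝ] E}
    (hsurj : ∀ y : E, ∃ x : A.domain, (x : E) - A x = y) (hD : Dense (A.domain : Set E))
    {B : ℕ → E →L[ℝ] E} (hB : ∀ n x, ⟪B n x, x⟫ ≤ 0) (hBB : ∀ m n, Commute (B m) (B n))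
    (hBA : ∀ x : A.domain, Tendsto (fun n => B n x) atTop (𝓝 (A x))) :
    GeneratesC0Contractions A := by
  have hcont : ∀ (t : ℝ≥0) n x, ‖NormedSpace.exp ((t : ℝ) • B n) x‖ ≤ ‖x‖ := fun t n x =>
    norm_exp_smul_apply_le (hB n) t.coe_nonneg x
  have hlim : ∀ (t : ℝ≥0) (x : E), ∃ y,
      Tendsto (fun n => NormedSpace.exp ((t : ℝ) • B n) x) atTop (𝓝 y) := fun t x => by
    refine exists_tendsto_of_dense (hcont t) hD (fun x hx => ?_) x
    have hc := (hBA ⟨x, hx⟩).cauchySeq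
    rw [Metric.cauchySeq_iff] at hc ⊢
    intro ε hε
    obtain ⟨N, hN⟩ := hc (ε / (t + 1)) (by positivity)
    refine ⟨N, fun m hm n hn => ?_⟩
    have h1 := hN m hm n hn
    have h2 := norm_exp_smul_apply_sub_le (hB m) (hB n) (hBB m n) t.coe_nonneg x
    rw [dist_eq_norm] at h1 ⊢
    rw [lt_div_iff₀ (by positivity)] at h1
    have h3 := norm_nonneg (B m x - B n x)
    change _ ≤ (t : ℝ) * _ at h2
    change ‖B m x - B n x‖ * ((t : ℝ) + 1) < ε at h1
    nlinarith
  choose T hT using hlim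
  have hTpi : ∀ t : ℝ≥0, Tendsto (fun n x => NormedSpace.exp ((t : ℝ) • B n) x) atTop
      (𝓝 (T t)) := fun t => tendsto_pi_nhds.2 (hT t)
  let S : ℝ≥0 → E →L[ℝ] E := fun t => continuousLinearMapOfTendsto _ (hTpi t)
  have hS : ∀ (t : ℝ≥0) x, Tendsto (fun n => NormedSpace.exp ((t : ℝ) • B n) x) atTop
      (𝓝 (S t x)) := hT
  have hSle : ∀ t x, ‖S t x‖ ≤ ‖x‖ := fun t x =>
    le_of_tendsto (hS t x).norm (Eventually.of_forall fun n => hcont t n x)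
  have hSdom : ∀ (t : ℝ≥0) (x : A.domain), ‖S t x - x‖ ≤ t * ‖A x‖ := fun t x =>
    le_of_tendsto_of_tendsto' ((hS t x).sub_const _).norm ((hBA x).norm.const_mul (t : ℝ))
      fun n => norm_exp_smul_apply_sub_self_le (hB n) t.coe_nonneg _
  have hcoe : Tendsto (fun t : ℝ≥0 => (t : ℝ)) (𝓝[>] 0) (𝓝 0) :=
    (NNReal.continuous_coe.tendsto 0).mono_left nhdsWithin_le_nhds
  have hgen : ∀ x : A.domain,
      Tendsto (fun t : ℝ≥0 => (t : ℝ)⁻¹ • (S t x - x)) (𝓝[>] 0) (𝓝 (A x)) := fun x => by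
    rw [Metric.tendsto_nhds]
    intro ε hε
    obtain ⟨u, hu, hxu⟩ := hD.exists_dist_lt (A x) (show 0 < ε / 4 by positivity)
    have hsmall : ∀ᶠ t : ℝ≥0 in 𝓝[>] 0, (t : ℝ) * ‖A ⟨u, hu⟩‖ < ε / 2 := by
      have := hcoe.mul_const ‖A ⟨u, hu⟩‖
      rw [zero_mul] at this
      exact this.eventually_lt_const (by positivity)
    filter_upwards [hsmall, self_mem_nhdsWithin] with t ht ht0
    have ht0' : (0 : ℝ) < t := ht0
    have hb : ‖S t x - x - (t : ℝ) • A x‖ ≤ t * (2 * ‖A x - u‖ + t * ‖A ⟨u, hu⟩‖) :=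
      le_of_tendsto_of_tendsto' (((hS t x).sub_const _).sub ((hBA x).const_smul (t : ℝ))).norm
        ((((hBA x).sub_const u).norm.const_mul 2).add
          ((hBA ⟨u, hu⟩).norm.const_mul (t : ℝ)) |>.const_mul (t : ℝ))
        fun n => norm_exp_smul_apply_sub_sub_le (hB n) t.coe_nonneg _ u
    have e : (t : ℝ)⁻¹ • (S t x - x) - A x = (t : ℝ)⁻¹ • (S t x - x - (t : ℝ) • A x) := by
      rw [smul_sub _ (S t x - (x : E)), inv_smul_smul₀ ht0'.ne']
    rw [dist_eq_norm] at hxu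
    rw [dist_eq_norm, e, norm_smul, norm_inv, Real.norm_of_nonneg ht0'.le,
      inv_mul_lt_iff₀ ht0']
    refine hb.trans_lt ?_
    gcongr
    linarith
  refine ⟨S, ⟨?_, ?_, ?_, ?_⟩, fun x y => ⟨?_, fun hy => ?_⟩⟩
  · ext x
    refine tendsto_nhds_unique (hS 0 x) ?_
    simp [NormedSpace.exp_zero]
  · intro s t
    ext x
    refine tendsto_nhds_unique (hS (s + t) x) ?_
    -- Contractivity allows the moving argument exp(tB n)x to be replaced by its limit S t x under
    -- exp(sB n).
    have h1 : Tendsto (fun n => NormedSpace.exp ((s : ℝ) • B n)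
        (NormedSpace.exp ((t : ℝ) • B n) x - S t x)) atTop (𝓝 0) := by
      refine squeeze_zero_norm (fun n => hcont s n _) ?_
      simpa using ((hS t x).sub_const (S t x)).norm
    have h2 := h1.add (hS s (S t x))
    simp only [map_sub, sub_add_cancel, zero_add] at h2
    simpa [NNReal.coe_add, exp_add_smul_apply] using h2
  · intro x
    rw [Metric.tendsto_nhds]
    intro ε hε
    obtain ⟨u, hu, hxu⟩ := hD.exists_dist_lt x (show 0 < ε / 3 by positivity)
    have hsmall : ∀ᶠ t : ℝ≥0 in 𝓝[>] 0, (t : ℝ) * ‖A ⟨u, hu⟩‖ < ε / 3 := by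
      have := hcoe.mul_const ‖A ⟨u, hu⟩‖
      rw [zero_mul] at this
      exact this.eventually_lt_const (by positivity)
    filter_upwards [hsmall] with t ht
    have h1 := hSdom t ⟨u, hu⟩
    have e : S t x - x = S t (x - u) + (S t u - u) - (x - u) := by
      simp only [map_sub]; abel
    rw [dist_eq_norm] at hxu
    rw [dist_eq_norm, e]
    have h2 := hSle t (x - u)
    have h4 := norm_sub_le (S t (x - u) + (S t u - u)) (x - u)
    have h5 := norm_add_le (S t (x - u)) (S t u - u)
    simp only at h1
    linarith
  · exact fun t => ContinuousLinearMap.opNorm_le_bound _ zero_le_one fun x => by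
      simpa using hSle t x
  · rintro ⟨hx, rfl⟩
    exact hgen ⟨x, hx⟩
  -- The generator of S extends A; equality follows from maximality. Solving x' − Ax' = x − y gives
  -- y − Ax' = x − x', which is also the derivative at zero of t ↦ S t (x − x'). As S is
  -- contractive, its inner product with x − x' is nonpositive, so x = x'.
  · obtain ⟨x', hx'⟩ := hsurj (x - y)
    have hd := hy.sub (hgen x')
    have he : y - A x' = x - x' := by
      rw [sub_eq_sub_iff_add_eq_add] at hx' ⊢
      rw [add_comm, hx']
    have hle : ⟪y - A x', x - x'⟫ ≤ 0 := by
      refine le_of_tendsto (hd.inner tendsto_const_nhds) ?_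
      filter_upwards [self_mem_nhdsWithin] with t ht0
      have ht0' : (0 : ℝ) < t := ht0
      rw [← smul_sub, real_inner_smul_left]
      refine mul_nonpos_of_nonneg_of_nonpos (by positivity) ?_
      have e : S t x - x - (S t x' - x') = S t (x - x') - (x - x') := by
        rw [map_sub]; abel
      rw [e, inner_sub_left, real_inner_self_eq_norm_sq]
      have h1 := real_inner_le_norm (S t (x - x')) (x - x')
      have h2 := mul_le_mul_of_nonneg_right (hSle t (x - x')) (norm_nonneg (x - x'))
      nlinarith
    rw [he, real_inner_self_nonpos, sub_eq_zero] at hle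
    subst hle
    rw [sub_self, sub_eq_zero] at he
    exact ⟨x'.2, he.symm⟩

/-- The domain of an m-dissipative operator is dense. -/
theorem dense_domain_of_dissipative {A : E →ₗ.[ℝ] E}
    (hA : ∀ x : A.domain, ⟪A x, (x : E)⟫ ≤ 0)
    (hsurj : ∀ y : E, ∃ x : A.domain, (x : E) - A x = y) : Dense (A.domain : Set E) := by
  rw [Submodule.dense_iff_topologicalClosure_eq_top,
    Submodule.topologicalClosure_eq_top_iff, Submodule.eq_bot_iff]
  intro y hy
  obtain ⟨x, rfl⟩ := hsurj y
  -- For y = x − Ax orthogonal to the domain, 0 = ⟪x, y⟫ = ‖x‖² − ⟪Ax, x⟫ ≥ ‖x‖².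
  have h1 := (Submodule.mem_orthogonal _ _).1 hy x x.2
  have h2 := hA x
  rw [inner_sub_right, real_inner_comm (A x)] at h1
  have h3 : (x : E) = 0 := real_inner_self_nonpos.1 (by linarith)
  have h4 : x = 0 := Subtype.ext h3
  simp [h4]

/-- **Lumer–Phillips theorem**: a dissipative operator `A` such that `r - A` is onto for all
`r > 0` generates a strongly continuous semigroup of contractions. -/
theorem generates_of_dissipative {A : E →ₗ.[ℝ] E}
    (hA : ∀ x : A.domain, ⟪A x, (x : E)⟫ ≤ 0)
    (hsurj : ∀ r : ℝ, 0 < r → ∀ y : E, ∃ x : A.domain, r • (x : E) - A x = y) :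
    GeneratesC0Contractions A := by
  have hsurj1 : ∀ y : E, ∃ x : A.domain, (x : E) - A x = y := fun y => by
    simpa using hsurj 1 one_pos y
  have hD := dense_domain_of_dissipative hA hsurj1
  -- Dissipativity bounds r − A below by r; hence r − A is injective and its inverse has norm at
  -- most 1/r.
  have hlow : ∀ r : ℝ, 0 < r → ∀ x : A.domain, r * ‖(x : E)‖ ≤ ‖r • (x : E) - A x‖ := by
    intro r hr x
    rcases eq_or_lt_of_le (norm_nonneg (x : E)) with h0 | h0
    · rw [← h0, mul_zero]; exact norm_nonneg _
    refine le_of_mul_le_mul_right ?_ h0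
    have h1 := real_inner_le_norm (r • (x : E) - A x) x
    rw [inner_sub_left, real_inner_smul_left, real_inner_self_eq_norm_sq] at h1
    nlinarith [hA x]
  have hinj : ∀ r : ℝ, 0 < r → ∀ x y : A.domain,
      r • (x : E) - A x = r • (y : E) - A y → x = y := by
    intro r hr x y h
    have h1 := hlow r hr (x - y)
    have e : r • ((x - y : A.domain) : E) - A (x - y) = 0 := by
      rw [LinearPMap.map_sub, Submodule.coe_sub, smul_sub, sub_sub_sub_comm, h, sub_self]
    rw [e, norm_zero] at h1
    have h2 : ‖((x - y : A.domain) : E)‖ = 0 := le_antisymm (by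
      by_contra hh
      push Not at hh
      nlinarith) (norm_nonneg _)
    rw [norm_eq_zero] at h2
    exact sub_eq_zero.1 (Subtype.ext h2)
  -- The shift by one keeps the resolvent parameter positive at n = 0.
  let r : ℕ → ℝ := fun n => n + 1
  have hr : ∀ n, 0 < r n := fun n => by positivity
  choose R hR using fun n => hsurj (r n) (hr n)
  have hRadd : ∀ n x y, R n (x + y) = R n x + R n y := fun n x y => by
    refine hinj (r n) (hr n) _ _ ?_
    rw [hR, LinearPMap.map_add, Submodule.coe_add, smul_add, add_sub_add_comm, hR, hR]
  have hRsmul : ∀ n (c : ℝ) x, R n (c • x) = c • R n x := fun n c x => by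
    refine hinj (r n) (hr n) _ _ ?_
    rw [hR, LinearPMap.map_smul, Submodule.coe_smul, smul_comm, ← smul_sub, hR]
  have hRle : ∀ n x, ‖(R n x : E)‖ ≤ (r n)⁻¹ * ‖x‖ := fun n x => by
    have := hlow (r n) (hr n) (R n x)
    rw [hR] at this
    rwa [inv_mul_eq_div, le_div_iff₀ (hr n), mul_comm]
  let Q : ℕ → E →L[ℝ] E := fun n => LinearMap.mkContinuous
    { toFun := fun x => (R n x : E)
      map_add' := fun x y => by rw [hRadd]; rfl
      map_smul' := fun c x => by rw [hRsmul]; rfl } (r n)⁻¹ (hRle n)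
  have hQ : ∀ n x, Q n x = R n x := fun n x => rfl
  have hRA : ∀ n (x : A.domain), R n (r n • (x : E) - A x) = x := fun n x =>
    hinj (r n) (hr n) _ _ (hR n _)
  have hAR : ∀ n x, A (R n x) = r n • (R n x : E) - x := fun n x => by
    have := hR n x
    rw [sub_eq_iff_eq_add] at this
    rw [this, add_sub_cancel_left]
  have hQQ : ∀ m n, Commute (Q m) (Q n) := by
    intro m n
    by_cases hmn : m = n
    · rw [hmn]
    -- The resolvent identity; exchanging m and n gives commutation after division by r n − r m ≠ 0.
    have hres : ∀ m n x, Q m x - Q n x = (r n - r m) • Q m (Q n x) := by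
      intro m n x
      have h1 : r n • Q m (Q n x) - Q m (A (R n x)) = Q m x := by
        rw [hQ n, ← map_smul, ← map_sub, hR]
      have h2 : r m • Q m (Q n x) - Q m (A (R n x)) = Q n x := by
        rw [hQ n, ← map_smul, ← map_sub, hQ m, hRA]
      calc Q m x - Q n x = r n • Q m (Q n x) - Q m (A (R n x))
            - (r m • Q m (Q n x) - Q m (A (R n x))) := by rw [h1, h2]
        _ = (r n - r m) • Q m (Q n x) := by rw [sub_smul]; abel
    ext x
    have h1 := hres m n x
    have h2 := hres n m x
    have hne : r n - r m ≠ 0 := sub_ne_zero.2 fun h => hmn (by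
      have : (n : ℝ) = m := by simpa [r] using h
      exact_mod_cast this.symm)
    have h3 : (r n - r m) • Q m (Q n x) = (r n - r m) • Q n (Q m x) := by
      rw [← h1, ← neg_sub (Q n x), h2, ← neg_smul, neg_sub]
    exact smul_right_injective E hne h3
  have hrQ : ∀ n (x : A.domain), A (R n x) = Q n (A x) := fun n x => by
    have h1 := hRA n x
    have h2 : Q n (r n • (x : E) - A x) = x := by rw [hQ, h1]
    rw [map_sub, map_smul, sub_eq_iff_eq_add] at h2
    rw [hAR, ← hQ, h2, add_sub_cancel_left]
  -- Yosida approximation: r(rQ − 1) = rAQ, which equals rQA on the domain.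
  let B : ℕ → E →L[ℝ] E := fun n => r n • (r n • Q n - 1)
  have hBR : ∀ n x, B n x = r n • A (R n x) := fun n x => by
    rw [hAR, ← hQ]; rfl
  have hQ1 : ∀ n x, ‖r n • Q n x‖ ≤ ‖x‖ := fun n x => by
    rw [norm_smul, Real.norm_of_nonneg (hr n).le, hQ]
    have := hRle n x
    rwa [inv_mul_eq_div, le_div_iff₀' (hr n)] at this
  refine generates_of_approximation hsurj1 hD (B := B) ?_ ?_ ?_
  · intro n x
    have e : x = r n • (R n x : E) - A (R n x) := (hR n x).symm
    have h1 : ⟪B n x, x⟫ = r n * (r n * ⟪A (R n x), (R n x : E)⟫ - ‖A (R n x)‖ ^ 2) := by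
      rw [hBR, real_inner_smul_left]
      nth_rewrite 2 [e]
      rw [inner_sub_right, real_inner_smul_right, real_inner_self_eq_norm_sq]
    rw [h1]
    refine mul_nonpos_of_nonneg_of_nonpos (hr n).le ?_
    have := mul_nonpos_of_nonneg_of_nonpos (hr n).le (hA (R n x))
    nlinarith [sq_nonneg ‖A (R n x)‖]
  · intro m n
    have h := hQQ m n
    have h1 : Commute (r m • Q m - 1) (r n • Q n - 1) :=
      (((h.smul_left _).smul_right _).sub_left (Commute.one_left _)).sub_right
        (Commute.one_right _)
    exact (h1.smul_left _).smul_right _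
  -- On the domain, rQx − x = QAx has norm at most ‖Ax‖/r. Density and ‖rQ‖ ≤ 1 extend the
  -- convergence to all of E.
  · have hconv : ∀ x : E, Tendsto (fun n => r n • Q n x) atTop (𝓝 x) := by
      intro x
      have hinv : Tendsto (fun n => (r n)⁻¹) atTop (𝓝 0) :=
        tendsto_inv_atTop_zero.comp (tendsto_atTop_add_const_right _ _ tendsto_natCast_atTop_atTop)
      have hdom : ∀ x : A.domain, Tendsto (fun n => r n • Q n (x : E) - x) atTop (𝓝 0) := by
        intro x
        refine squeeze_zero_norm (a := fun n => (r n)⁻¹ * ‖A x‖) (fun n => ?_)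
          (by simpa using hinv.mul_const ‖A x‖)
        rw [hQ, ← hAR, hrQ, hQ]
        exact hRle n _
      rw [Metric.tendsto_nhds]
      intro ε hε
      obtain ⟨u, hu, hxu⟩ := hD.exists_dist_lt x (show 0 < ε / 3 by positivity)
      have h1 := (hdom ⟨u, hu⟩).norm
      rw [norm_zero] at h1
      filter_upwards [h1.eventually_lt_const (show 0 < ε / 3 by positivity)] with n hn
      have e : r n • Q n x - x = r n • Q n (x - u) + (r n • Q n u - u) - (x - u) := by
        rw [map_sub, smul_sub]; abel
      rw [dist_eq_norm] at hxu
      rw [dist_eq_norm, e]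
      have h2 := hQ1 n (x - u)
      have h4 := norm_sub_le (r n • Q n (x - u) + (r n • Q n u - u)) (x - u)
      have h5 := norm_add_le (r n • Q n (x - u)) (r n • Q n u - u)
      linarith
    intro x
    refine (hconv (A x)).congr fun n => ?_
    rw [hBR, hrQ]

end LumerPhillips

/-! ### The Volterra operator on `L²(0, l)` -/

section Volterra

open scoped RealInnerProductSpace

variable {l : ℝ}

/-- The primitive of `w` that vanishes at the origin. -/
def prim (w : L2 l) (y : ℝ) : ℝ := ∫ s in (0 : ℝ)..y, w s

theorem setIntegral_Ioo_eq (hl : 0 < l) (f : ℝ → ℝ) :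
    ∫ y in Ioo 0 l, f y = ∫ y in (0 : ℝ)..l, f y := by
  rw [intervalIntegral.integral_of_le hl.le, integral_Ioc_eq_integral_Ioo]

theorem intervalIntegrable_L2 (hl : 0 < l) (w : L2 l) : IntervalIntegrable w volume 0 l :=
  (intervalIntegrable_iff_integrableOn_Ioo_of_le hl.le).2 ((Lp.memLp w).integrable (by norm_num))

theorem prim_zero (w : L2 l) : prim w 0 = 0 := intervalIntegral.integral_same

theorem absolutelyContinuous_prim (hl : 0 < l) (w : L2 l) :
    AbsolutelyContinuousOnInterval (prim w) 0 l :=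
  (intervalIntegrable_L2 hl w).absolutelyContinuousOnInterval_intervalIntegral (by simp)

theorem ae_deriv_prim (hl : 0 < l) (w : L2 l) : deriv (prim w) =ᵐ[leb l] w := by
  refine (ae_restrict_iff' measurableSet_Ioo).2 ?_
  filter_upwards [(intervalIntegrable_L2 hl w).ae_hasDerivAt_integral] with y hy hm
  exact (hy (by rw [uIcc_of_le hl.le]; exact Ioo_subset_Icc_self hm) 0 (by simp)).deriv

theorem memLp_of_continuousOn {u : ℝ → ℝ} (hu : ContinuousOn u (Icc 0 l)) :
    MemLp u 2 (leb l) := by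
  obtain ⟨C, hC⟩ := isCompact_Icc.exists_bound_of_continuousOn hu
  refine MemLp.of_bound ((hu.mono Ioo_subset_Icc_self).aestronglyMeasurable measurableSet_Ioo) C ?_
  filter_upwards [ae_restrict_mem measurableSet_Ioo] with y hy
  exact hC y (Ioo_subset_Icc_self hy)

theorem memLp_prim (hl : 0 < l) (w : L2 l) : MemLp (prim w) 2 (leb l) := by
  have := (absolutelyContinuous_prim hl w).continuousOn
  rw [uIcc_of_le hl.le] at this
  exact memLp_of_continuousOn this

theorem prim_congr {w : L2 l} {v : ℝ → ℝ} (h : w =ᵐ[leb l] v) {y : ℝ}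
    (hy : y ∈ Icc 0 l) : prim w y = ∫ s in (0 : ℝ)..y, v s := by
  refine intervalIntegral.integral_congr_ae ?_
  have h' : ∀ᵐ s ∂(volume.restrict (Ioc 0 l)), w s = v s := by
    rw [← restrict_Ioo_eq_restrict_Ioc]; exact h
  filter_upwards [(ae_restrict_iff' measurableSet_Ioc).1 h'] with s hs hm
  rw [uIoc_of_le hy.1] at hm
  exact hs ⟨hm.1, hm.2.trans hy.2⟩

theorem prim_add (hl : 0 < l) (w w' : L2 l) {y : ℝ} (hy : y ∈ Icc 0 l) :
    prim (w + w') y = prim w y + prim w' y := by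
  have hsub : uIcc 0 y ⊆ uIcc 0 l := by
    rw [uIcc_of_le hy.1, uIcc_of_le hl.le]; exact Icc_subset_Icc_right hy.2
  rw [prim_congr (Lp.coeFn_add w w') hy]
  exact intervalIntegral.integral_add ((intervalIntegrable_L2 hl w).mono_set hsub)
    ((intervalIntegrable_L2 hl w').mono_set hsub)

theorem prim_smul (c : ℝ) (w : L2 l) {y : ℝ} (hy : y ∈ Icc 0 l) :
    prim (c • w) y = c * prim w y := by
  rw [prim_congr (Lp.coeFn_smul c w) hy]
  exact intervalIntegral.integral_const_mul c _

theorem L2_inner_eq (u v : L2 l) : ⟪u, v⟫ = ∫ y in Ioo 0 l, u y * v y := by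
  rw [L2.inner_def]
  refine integral_congr_ae (Eventually.of_forall fun y => ?_)
  simp [mul_comm]

theorem integral_deriv_mul_add (hl : 0 < l) {u v u' v' : ℝ → ℝ}
    (hu : AbsolutelyContinuousOnInterval u 0 l) (hv : AbsolutelyContinuousOnInterval v 0 l)
    (hu' : deriv u =ᵐ[leb l] u') (hv' : deriv v =ᵐ[leb l] v') :
    ∫ y in Ioo 0 l, (u' y * v y + u y * v' y) = u l * v l - u 0 * v 0 := by
  rw [← hu.integral_deriv_mul_eq_sub hv, ← setIntegral_Ioo_eq hl]
  refine integral_congr_ae ?_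
  filter_upwards [hu', hv'] with y h1 h2
  rw [h1, h2]

/-- The sharp Poincaré inequality, up to an arbitrarily small loss. -/
theorem poincare_aux (hl : 0 < l) {c : ℝ} (hc : 0 < c) (hcl : c * l < Real.pi / 2) (w : L2 l) :
    c ^ 2 * ∫ y in Ioo 0 l, prim w y ^ 2 ≤ ∫ y in Ioo 0 l, w y ^ 2 := by
  set u := prim w with hu_def
  have hu := absolutelyContinuous_prim hl w
  have hcu : ContinuousOn u (Icc 0 l) := by
    have := hu.continuousOn
    rwa [uIcc_of_le hl.le] at this
  -- q solves the Riccati equation q' = −(c² + q²) with q(l) = 0; the condition cl < π/2 keeps the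
  -- tangent finite on [0,l]. The integral of (u²q)' vanishes because u(0) = 0 and q(l) = 0, and w²
  -- − c²u² − (u²q)' = (w − qu)² ≥ 0.
  let q : ℝ → ℝ := fun y => c * Real.tan (c * (l - y))
  have hcos : ∀ y ∈ Icc 0 l, Real.cos (c * (l - y)) ≠ 0 := fun y hy => by
    refine (Real.cos_pos_of_mem_Ioo ⟨?_, ?_⟩).ne'
    · have : 0 ≤ c * (l - y) := mul_nonneg hc.le (by linarith [hy.2])
      linarith [Real.pi_pos]
    · nlinarith [hy.1]
  have hqd : ∀ y ∈ Icc 0 l, HasDerivAt q (-(c ^ 2 + q y ^ 2)) y := fun y hy => by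
    have h1 : HasDerivAt (fun y => c * (l - y)) (c * (-1)) y :=
      ((hasDerivAt_id y).const_sub l).const_mul c
    have h2 := ((Real.hasDerivAt_tan (hcos y hy)).comp y h1).const_mul c
    refine h2.congr_deriv ?_
    have h3 := Real.inv_one_add_tan_sq (hcos y hy)
    have h4 : 1 / Real.cos (c * (l - y)) ^ 2 = 1 + Real.tan (c * (l - y)) ^ 2 := by
      rw [← h3, one_div, inv_inv]
    rw [h4]
    simp only [q]
    ring
  have hcq : ContinuousOn q (Icc 0 l) := fun y hy =>
    (hqd y hy).continuousAt.continuousWithinAt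
  have hq : AbsolutelyContinuousOnInterval q 0 l := by
    refine ContDiffOn.absolutelyContinuousOnInterval ?_
    rw [uIcc_of_le hl.le]
    intro y hy
    refine ContDiffAt.contDiffWithinAt ?_
    have h1 : ContDiffAt ℝ 1 (fun y => c * (l - y)) y := by fun_prop
    have h2 : ContDiffAt ℝ 1 Real.tan (c * (l - y)) := Real.contDiffAt_tan.2 (hcos y hy)
    exact contDiffAt_const.mul (ContDiffAt.comp (g := Real.tan) y h2 h1)
  have hq' : deriv q =ᵐ[leb l] fun y => -(c ^ 2 + q y ^ 2) := by
    filter_upwards [ae_restrict_mem measurableSet_Ioo] with y hy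
    exact (hqd y (Ioo_subset_Icc_self hy)).deriv
  have huu : deriv (fun y => u y * u y) =ᵐ[leb l] fun y => 2 * u y * w y := by
    have hdiff : ∀ᵐ y ∂(leb l), DifferentiableAt ℝ u y := by
      refine (ae_restrict_iff' measurableSet_Ioo).2 ?_
      filter_upwards [hu.ae_differentiableAt] with y hy hm
      exact hy (by rw [uIcc_of_le hl.le]; exact Ioo_subset_Icc_self hm)
    filter_upwards [hdiff, ae_deriv_prim hl w] with y h1 h2
    rw [deriv_fun_mul h1 h1, h2]
    ring
  have key := integral_deriv_mul_add hl (hu.fun_mul hu) hq huu hq'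
  have hq0 : q l = 0 := by simp [q]
  rw [hq0, hu_def, prim_zero, ← hu_def, mul_zero, zero_mul, zero_mul, sub_zero] at key
  have iw : Integrable (fun y => w y ^ 2) (leb l) := (Lp.memLp w).integrable_sq
  have iu : Integrable (fun y => u y ^ 2) (leb l) := (memLp_prim hl w).integrable_sq
  have iqu : MemLp (fun y => q y * u y) 2 (leb l) := memLp_of_continuousOn (hcq.mul hcu)
  have i1 : Integrable (fun y => 2 * u y * w y * q y + u y * u y * -(c ^ 2 + q y ^ 2)) (leb l) := by
    have := (((iqu.integrable_mul (Lp.memLp w)).const_mul 2).sub (iu.const_mul (c ^ 2))).sub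
      iqu.integrable_sq
    refine this.congr (Eventually.of_forall fun y => ?_)
    simp only [Pi.sub_apply, Pi.mul_apply]
    ring
  have hle : ∫ y in Ioo 0 l, (2 * u y * w y * q y + u y * u y * -(c ^ 2 + q y ^ 2))
      ≤ ∫ y in Ioo 0 l, (w y ^ 2 - c ^ 2 * u y ^ 2) := by
    refine integral_mono i1 (iw.sub (iu.const_mul _)) fun y => ?_
    nlinarith [sq_nonneg (w y - q y * u y)]
  rw [key, integral_sub iw (iu.const_mul _), integral_const_mul] at hle
  linarith

/-- The sharp Poincaré (Wirtinger) inequality for functions that vanish at the origin. -/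
theorem poincare (hl : 0 < l) (w : L2 l) :
    ∫ y in Ioo 0 l, prim w y ^ 2 ≤ (2 * l / Real.pi) ^ 2 * ∫ y in Ioo 0 l, w y ^ 2 := by
  have hpi := Real.pi_pos
  have h : (Real.pi / (2 * l)) ^ 2 * ∫ y in Ioo 0 l, prim w y ^ 2 ≤ ∫ y in Ioo 0 l, w y ^ 2 := by
    have ht : Tendsto (fun c : ℝ => c ^ 2 * ∫ y in Ioo 0 l, prim w y ^ 2)
        (𝓝[<] (Real.pi / (2 * l)))
        (𝓝 ((Real.pi / (2 * l)) ^ 2 * ∫ y in Ioo 0 l, prim w y ^ 2)) :=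
      (Continuous.tendsto (by fun_prop) _).mono_left nhdsWithin_le_nhds
    refine le_of_tendsto ht ?_
    -- At c = π/(2l) itself q blows up at the root, so the sharp constant is reached only as a limit
    -- from below.
    filter_upwards [Ioo_mem_nhdsLT (show 0 < Real.pi / (2 * l) by positivity)] with c hc
    refine poincare_aux hl hc.1 ?_ w
    have := hc.2
    rw [lt_div_iff₀ (by positivity)] at this
    linarith
  have e : (Real.pi / (2 * l)) ^ 2 = ((2 * l / Real.pi) ^ 2)⁻¹ := by
    rw [← inv_pow, inv_div]
  rwa [e, inv_mul_le_iff₀ (by positivity)] at h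

theorem norm_toLp_prim_le (hl : 0 < l) (w : L2 l) :
    ‖(memLp_prim hl w).toLp (prim w)‖ ≤ 2 * l / Real.pi * ‖w‖ := by
  have hpi := Real.pi_pos
  refine (pow_le_pow_iff_left₀ (norm_nonneg _) (by positivity) two_ne_zero).1 ?_
  rw [mul_pow, ← real_inner_self_eq_norm_sq, ← real_inner_self_eq_norm_sq, L2_inner_eq,
    L2_inner_eq]
  have h := poincare hl w
  simp only [sq (prim w _), sq ((w : ℝ → ℝ) _)] at h
  refine le_trans (le_of_eq (integral_congr_ae ?_)) h
  filter_upwards [(memLp_prim hl w).coeFn_toLp] with y hy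
  rw [hy]

/-- The Volterra operator `w ↦ ∫₀ʸ w` on `L²(0, l)`. -/
def volterra (hl : 0 < l) : L2 l →L[ℝ] L2 l :=
  LinearMap.mkContinuous
    { toFun := fun w => (memLp_prim hl w).toLp _
      map_add' := fun w w' => by
        rw [← MemLp.toLp_add]
        refine MemLp.toLp_congr _ _ ?_
        filter_upwards [ae_restrict_mem measurableSet_Ioo] with y hy
        exact prim_add hl w w' (Ioo_subset_Icc_self hy)
      map_smul' := fun c w => by
        rw [RingHom.id_apply, ← MemLp.toLp_const_smul]
        refine MemLp.toLp_congr _ _ ?_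
        filter_upwards [ae_restrict_mem measurableSet_Ioo] with y hy
        exact prim_smul c w (Ioo_subset_Icc_self hy) }
    (2 * l / Real.pi) (norm_toLp_prim_le hl)

variable (hl : 0 < l)

theorem coeFn_volterra (w : L2 l) : volterra hl w =ᵐ[leb l] prim w :=
  (memLp_prim hl w).coeFn_toLp

theorem norm_volterra_le (w : L2 l) : ‖volterra hl w‖ ≤ 2 * l / Real.pi * ‖w‖ :=
  (volterra hl).le_of_opNorm_le
    (LinearMap.mkContinuous_norm_le _ (by have := Real.pi_pos; positivity) _) w

/-- The constant function `1` in `L²(0, l)`. -/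
def oneL2 (l : ℝ) : L2 l := MemLp.toLp (fun _ => (1 : ℝ)) (memLp_const 1)

theorem coeFn_oneL2 : oneL2 l =ᵐ[leb l] fun _ => 1 :=
  MemLp.coeFn_toLp (memLp_const 1)

theorem inner_oneL2 (hl : 0 < l) (w : L2 l) : ⟪oneL2 l, w⟫ = prim w l := by
  rw [L2_inner_eq, prim, ← setIntegral_Ioo_eq hl]
  refine integral_congr_ae ?_
  filter_upwards [coeFn_oneL2] with y hy
  rw [hy, one_mul]

theorem hasValueAt_volterra_left (w : L2 l) : HasValueAt (volterra hl w) 0 0 :=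
  ⟨prim w, absolutelyContinuous_prim hl w, coeFn_volterra hl w, prim_zero w⟩

theorem hasValueAt_volterra_right (w : L2 l) : HasValueAt (volterra hl w) l ⟪oneL2 l, w⟫ :=
  ⟨prim w, absolutelyContinuous_prim hl w, coeFn_volterra hl w, (inner_oneL2 hl w).symm⟩

theorem hasValueAt_oneL2 (y : ℝ) : HasValueAt (oneL2 l) y 1 :=
  ⟨fun _ => 1, ContDiffOn.absolutelyContinuousOnInterval contDiffOn_const, coeFn_oneL2, rfl⟩

theorem inner_volterra_add (u v : L2 l) :
    ⟪volterra hl u, v⟫ + ⟪u, volterra hl v⟫ = ⟪oneL2 l, u⟫ * ⟪oneL2 l, v⟫ := by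
  have h := integral_deriv_mul_add hl (absolutelyContinuous_prim hl u)
    (absolutelyContinuous_prim hl v) (ae_deriv_prim hl u) (ae_deriv_prim hl v)
  rw [prim_zero, zero_mul, sub_zero] at h
  rw [inner_oneL2 hl, inner_oneL2 hl, ← h, L2_inner_eq, L2_inner_eq, ← integral_add]
  · refine integral_congr_ae ?_
    filter_upwards [coeFn_volterra hl u, coeFn_volterra hl v] with y h1 h2
    rw [h1, h2, add_comm]
  · exact MemLp.integrable_mul (Lp.memLp _) (Lp.memLp v)
  · exact MemLp.integrable_mul (Lp.memLp u) (Lp.memLp _)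

/-- Integration by parts: V*G is y ↦ ∫ from y to l of G. It vanishes at the tip and has derivative
−G, which is why tip conditions are expressed through V*. -/
theorem adjoint_volterra (G : L2 l) :
    (volterra hl).adjoint G = ⟪oneL2 l, G⟫ • oneL2 l - volterra hl G := by
  refine ext_inner_right ℝ fun v => ?_
  rw [ContinuousLinearMap.adjoint_inner_left, inner_sub_left, real_inner_smul_left,
    ← inner_volterra_add hl]
  ring

/-! ### Weak derivatives and primitives -/

theorem test_eq_zero {φ : ℝ → ℝ} (hs : tsupport φ ⊆ Ioo 0 l) {y : ℝ} (hy : y ∉ Ioo 0 l) :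
    φ y = 0 := image_eq_zero_of_notMem_tsupport fun h => hy (hs h)

theorem isWeakDeriv_volterra (w : L2 l) : IsWeakDeriv (volterra hl w) w := by
  intro φ hφ hc hs
  have h := integral_deriv_mul_add hl (absolutelyContinuous_prim hl w)
    (ContDiffOn.absolutelyContinuousOnInterval (hφ.of_le (by norm_num)).contDiffOn)
    (ae_deriv_prim hl w) (EventuallyEq.refl _ (deriv φ))
  rw [test_eq_zero hs (y := l) (by simp), test_eq_zero hs (y := 0) (by simp), mul_zero, mul_zero,
    sub_zero] at h
  have hd : Continuous (deriv φ) := hφ.continuous_deriv (by norm_num)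
  rw [eq_neg_iff_add_eq_zero, add_comm, ← integral_add (integrable_mul_test w hφ.continuous hc)
    (integrable_mul_test _ hd hc.deriv), ← h]
  refine integral_congr_ae ?_
  filter_upwards [coeFn_volterra hl w] with y hy
  rw [hy]

theorem wd_volterra (w : L2 l) : wd (volterra hl w) = w := (isWeakDeriv_volterra hl w).wd_eq

theorem volterra_mem_H1 (w : L2 l) : volterra hl w ∈ H1 l := ⟨w, isWeakDeriv_volterra hl w⟩

theorem isWeakDeriv_oneL2 (hl : 0 < l) : IsWeakDeriv (oneL2 l) 0 := by
  intro φ hφ hc hs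
  have e1 : ∫ y in Ioo 0 l, (oneL2 l) y * deriv φ y = ∫ y in Ioo 0 l, deriv φ y := by
    refine integral_congr_ae ?_
    filter_upwards [coeFn_oneL2] with y hy
    rw [hy, one_mul]
  have e2 : ∫ y in Ioo 0 l, (0 : L2 l) y * φ y = 0 := by
    rw [integral_eq_zero_of_ae]
    filter_upwards [Lp.coeFn_zero ℝ 2 (leb l)] with y hy
    rw [hy]
    exact zero_mul _
  have hac : AbsolutelyContinuousOnInterval φ 0 l :=
    ContDiffOn.absolutelyContinuousOnInterval (hφ.of_le (by norm_num)).contDiffOn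
  rw [e1, e2, setIntegral_Ioo_eq hl, hac.integral_deriv_eq_sub,
    test_eq_zero hs (y := l) (by simp), test_eq_zero hs (y := 0) (by simp), sub_zero, neg_zero]

/-- A test function of zero mean is the derivative of a test function. -/
theorem exists_test_primitive (hl : 0 < l) {ψ : ℝ → ℝ} (hψ : ContDiff ℝ (⊤ : ℕ∞) ψ)
    (hc : HasCompactSupport ψ) (hs : tsupport ψ ⊆ Ioo 0 l)
    (h0 : ∫ y in Ioo 0 l, ψ y = 0) :
    ∃ φ : ℝ → ℝ, ContDiff ℝ (⊤ : ℕ∞) φ ∧ HasCompactSupport φ ∧ tsupport φ ⊆ Ioo 0 l ∧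
      deriv φ = ψ := by
  obtain ⟨a, b, ha, hb, hab⟩ : ∃ a b, 0 < a ∧ b < l ∧ tsupport ψ ⊆ Icc a b := by
    rcases (tsupport ψ).eq_empty_or_nonempty with he | hne
    -- With empty support, a = l and b = 0 meet both strict bounds and Icc a b is empty.
    · exact ⟨l, 0, hl, hl, by simp [he]⟩
    obtain ⟨a, ha, ha'⟩ := hc.isCompact.exists_isLeast hne
    obtain ⟨b, hb, hb'⟩ := hc.isCompact.exists_isGreatest hne
    exact ⟨a, b, (hs ha).1, (hs hb).2, fun y hy => ⟨ha' hy, hb' hy⟩⟩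
  have hz : ∀ y, y ∉ Icc a b → ψ y = 0 := fun y hy =>
    image_eq_zero_of_notMem_tsupport fun h => hy (hab h)
  have hint : ∀ c d : ℝ, IntervalIntegrable ψ volume c d := fun c d =>
    hψ.continuous.intervalIntegrable c d
  let φ : ℝ → ℝ := fun y => ∫ s in (0 : ℝ)..y, ψ s
  have hd : ∀ y, HasDerivAt φ (ψ y) y := fun y =>
    intervalIntegral.integral_hasDerivAt_right (hint _ _)
      (hψ.continuous.stronglyMeasurableAtFilter _ _) hψ.continuous.continuousAt
  have hdφ : deriv φ = ψ := funext fun y => (hd y).deriv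
  have hφz : ∀ y, y ∉ Icc a b → φ y = 0 := fun y hy => by
    rcases lt_or_ge y a with h | h
    · refine (intervalIntegral.integral_congr (g := fun _ => 0)
        fun s hs => hz s fun hs' => ?_).trans
        (by simp)
      rcases le_total 0 y with h' | h'
      · rw [uIcc_of_le h'] at hs
        linarith [hs.2, hs'.1]
      · rw [uIcc_of_ge h'] at hs
        linarith [hs.2, hs'.1]
    · have hby : b < y := lt_of_not_ge fun h' => hy ⟨h, h'⟩
      have e : φ y = (∫ s in (0 : ℝ)..l, ψ s) + ∫ s in l..y, ψ s :=
        (intervalIntegral.integral_add_adjacent_intervals (hint _ _) (hint _ _)).symm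
      rw [e, ← setIntegral_Ioo_eq hl, h0, zero_add]
      refine (intervalIntegral.integral_congr (g := fun _ => 0)
        fun s hs => hz s fun hs' => ?_).trans
        (by simp)
      have := hs.1
      rcases le_total l y with h' | h'
      · rw [min_eq_left h'] at this
        linarith [hs'.2]
      · rw [min_eq_right h'] at this
        linarith [hs'.2]
  have hts : tsupport φ ⊆ Icc a b :=
    closure_minimal (fun y hy => by_contra fun h => hy (hφz y h)) isClosed_Icc
  refine ⟨φ, ?_, ?_, hts.trans fun y hy => ⟨ha.trans_le hy.1, hy.2.trans_lt hb⟩, hdφ⟩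
  · rw [contDiff_infty_iff_deriv, hdφ]
    exact ⟨fun y => (hd y).differentiableAt, hψ⟩
  · exact isCompact_Icc.of_isClosed_subset (isClosed_tsupport φ) hts

theorem exists_test_integral_eq_one (hl : 0 < l) :
    ∃ χ : ℝ → ℝ, ContDiff ℝ (⊤ : ℕ∞) χ ∧ HasCompactSupport χ ∧ tsupport χ ⊆ Ioo 0 l ∧
      ∫ y in Ioo 0 l, χ y = 1 := by
  let f : ContDiffBump (l / 2) := ⟨l / 8, l / 4, by positivity, by linarith⟩
  have hs : tsupport (f.normed volume) ⊆ Ioo 0 l := by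
    rw [f.tsupport_normed_eq, Real.closedBall_eq_Icc]
    intro y hy
    have h1 : l / 2 - l / 4 ≤ y := hy.1
    have h2 : y ≤ l / 2 + l / 4 := hy.2
    exact ⟨by linarith, by linarith⟩
  refine ⟨f.normed volume, f.contDiff_normed, f.hasCompactSupport_normed, hs, ?_⟩
  rw [setIntegral_eq_integral_of_forall_compl_eq_zero fun y hy => test_eq_zero hs hy]
  exact f.integral_normed

/-- A function with vanishing weak derivative is constant. -/
theorem IsWeakDeriv.eq_const (hl : 0 < l) {u : L2 l} (h : IsWeakDeriv u 0) :
    ∃ c : ℝ, u = c • oneL2 l := by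
  obtain ⟨χ, hχ, hχc, hχs, hχ1⟩ := exists_test_integral_eq_one hl
  refine ⟨∫ y in Ioo 0 l, u y * χ y, ?_⟩
  set c := ∫ y in Ioo 0 l, u y * χ y with hc_def
  have hzero : ∀ φ : ℝ → ℝ, ∫ y in Ioo 0 l, (0 : L2 l) y * φ y = 0 := fun φ => by
    rw [integral_eq_zero_of_ae]
    filter_upwards [Lp.coeFn_zero ℝ 2 (leb l)] with y hy
    rw [hy]
    exact zero_mul _
  have hloc : LocallyIntegrableOn (fun y => u y - c) (Ioo 0 l) volume :=
    IntegrableOn.locallyIntegrableOn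
      (((Lp.memLp u).integrable (by norm_num)).sub (integrable_const c))
  have key := isOpen_Ioo.ae_eq_zero_of_integral_contDiff_smul_eq_zero hloc (by
    intro ψ hψ hψc hψs
    rw [← setIntegral_eq_integral_of_forall_compl_eq_zero (s := Ioo 0 l) fun y hy => by
      rw [test_eq_zero hψs hy, zero_smul]]
    have iψ : Integrable ψ (leb l) := (hψ.continuous.integrable_of_hasCompactSupport hψc).restrict
    have iχ : Integrable χ (leb l) := (hχ.continuous.integrable_of_hasCompactSupport hχc).restrict
    set m := ∫ y in Ioo 0 l, ψ y with hm
    -- Subtracting m χ gives zero mean, so the difference is the derivative of a test function and u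
    -- annihilates it.
    obtain ⟨φ, hφ, hφc, hφs, hφd⟩ := exists_test_primitive hl (ψ := fun y => ψ y - m * χ y)
      (hψ.sub (contDiff_const.mul hχ)) (hψc.sub (hχc.mul_left))
      ((tsupport_sub ψ _).trans (union_subset hψs
        ((tsupport_mul_subset_right (f := fun _ => m)).trans hχs))) (by
        rw [integral_sub iψ (iχ.const_mul m), integral_const_mul, hχ1, mul_one, sub_self])
    have h1 := h φ hφ hφc hφs
    rw [hzero, neg_zero, hφd] at h1
    have e1 : ∫ y in Ioo 0 l, u y * (ψ y - m * χ y)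
        = (∫ y in Ioo 0 l, u y * ψ y) - m * c := by
      rw [hc_def, ← integral_const_mul, ← integral_sub (integrable_mul_test u hψ.continuous hψc)
        ((integrable_mul_test u hχ.continuous hχc).const_mul m)]
      congr 1
      ext y
      ring
    have e2 : ∫ y in Ioo 0 l, ψ y • (u y - c) = (∫ y in Ioo 0 l, u y * ψ y) - c * m := by
      rw [hm, ← integral_const_mul, ← integral_sub (integrable_mul_test u hψ.continuous hψc)
        (iψ.const_mul c)]
      congr 1
      ext y
      simp only [smul_eq_mul]
      ring
    rw [e2]
    linarith)
  refine Lp.ext ?_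
  have key' := (ae_restrict_iff' measurableSet_Ioo).2 key
  filter_upwards [key', Lp.coeFn_smul c (oneL2 l), coeFn_oneL2] with y h1 h2 h3
  rw [h2, Pi.smul_apply, h3, smul_eq_mul, mul_one]
  linarith

/-- u − V(wd u) has vanishing weak derivative. A known value at the root or at the tip then fixes
the constant. -/
theorem eq_volterra_add_const {u : L2 l} (hu : u ∈ H1 l) :
    ∃ c : ℝ, u = volterra hl (wd u) + c • oneL2 l := by
  have h := (isWeakDeriv_wd hu).add ((isWeakDeriv_volterra hl (wd u)).smul (-1))
  rw [neg_one_smul, neg_one_smul, add_neg_cancel] at h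
  obtain ⟨c, hc⟩ := h.eq_const hl
  exact ⟨c, by rw [← hc]; abel⟩

theorem eq_volterra_wd {u : L2 l} (hu : u ∈ H1 l) (h0 : HasValueAt u 0 0) :
    u = volterra hl (wd u) := by
  obtain ⟨c, hc⟩ := eq_volterra_add_const hl hu
  have h1 := (hasValueAt_volterra_left hl (wd u)).add ((hasValueAt_oneL2 (l := l) 0).smul c)
  rw [← hc] at h1
  have h2 := h1.unique hl (left_mem_Icc.2 hl.le) h0
  have h3 : c = 0 := by simpa using h2
  rw [h3, zero_smul, add_zero] at hc
  exact hc

theorem eq_const_sub_adjoint_wd {u : L2 l} (hu : u ∈ H1 l) {a : ℝ} (ha : HasValueAt u l a) :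
    u = a • oneL2 l - (volterra hl).adjoint (wd u) := by
  obtain ⟨c, hc⟩ := eq_volterra_add_const hl hu
  have h1 := (hasValueAt_volterra_right hl (wd u)).add ((hasValueAt_oneL2 (l := l) l).smul c)
  rw [← hc] at h1
  have h2 := h1.unique hl (right_mem_Icc.2 hl.le) ha
  rw [adjoint_volterra, ← h2]
  nth_rewrite 1 [hc]
  rw [mul_one, add_smul]
  abel

theorem isWeakDeriv_adjoint_volterra (a : ℝ) (G : L2 l) :
    IsWeakDeriv (a • oneL2 l - (volterra hl).adjoint G) G := by
  rw [adjoint_volterra]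
  have h := ((isWeakDeriv_oneL2 hl).smul (a - ⟪oneL2 l, G⟫)).add (isWeakDeriv_volterra hl G)
  rw [smul_zero, zero_add] at h
  convert h using 1
  rw [sub_smul]
  abel

theorem hasValueAt_adjoint_volterra (a : ℝ) (G : L2 l) :
    HasValueAt (a • oneL2 l - (volterra hl).adjoint G) l a := by
  rw [adjoint_volterra]
  have h := ((hasValueAt_oneL2 (l := l) l).smul (a - ⟪oneL2 l, G⟫)).add
    (hasValueAt_volterra_right hl G)
  convert h using 1
  · rw [sub_smul]
    abel
  · ring

end Volterra

/-! ### Multiplication operators -/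

section Multiplication

open scoped RealInnerProductSpace

variable {l : ℝ}

/-- Multiplication by `a ∈ L^∞(0, l)` as a bounded operator on `L²(0, l)`. -/
def mulOp (a : Linf l) : L2 l →L[ℝ] L2 l :=
  LinearMap.mkContinuous
    { toFun := mulL a
      map_add' := mulL_add a
      map_smul' := mulL_smul a } ‖a‖ (fun u => Lp.norm_smul_le a u)

theorem mulOp_apply (a : Linf l) (u : L2 l) : mulOp a u = mulL a u := rfl

theorem coeFn_mulL (a : Linf l) (u : L2 l) : mulL a u =ᵐ[leb l] fun y => a y * u y :=
  Lp.coeFn_lpSMul a u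

theorem integrable_L2_mul (u v : L2 l) : Integrable (fun y => u y * v y) (leb l) :=
  MemLp.integrable_mul (Lp.memLp u) (Lp.memLp v)

theorem inner_mulL (a : Linf l) (u v : L2 l) :
    ⟪mulL a u, v⟫ = ∫ y in Ioo 0 l, a y * u y * v y := by
  rw [L2_inner_eq]
  refine integral_congr_ae ?_
  filter_upwards [coeFn_mulL a u] with y hy
  rw [hy]

theorem integrable_mulL (a : Linf l) (u v : L2 l) :
    Integrable (fun y => a y * u y * v y) (leb l) := by
  refine (integrable_L2_mul (mulL a u) v).congr ?_
  filter_upwards [coeFn_mulL a u] with y hy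
  rw [hy]

theorem inner_mulL_comm (a : Linf l) (u v : L2 l) : ⟪mulL a u, v⟫ = ⟪mulL a v, u⟫ := by
  rw [inner_mulL, inner_mulL]
  refine integral_congr_ae (Eventually.of_forall fun y => ?_)
  ring

theorem mulL_recip_mulL (a : Linf l) (ha : 0 < essInf a (leb l))
    (hpos : ∀ᵐ y ∂(leb l), 0 < a y) (u : L2 l) : mulL (recip a ha) (mulL a u) = u := by
  refine Lp.ext ?_
  filter_upwards [hpos, coeFn_mulL (recip a ha) (mulL a u), coeFn_mulL a u,
    (memLp_inv a ha).coeFn_toLp] with y h0 h1 h2 h3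
  have h4 : (recip a ha) y = (a y)⁻¹ := h3
  rw [h1, h2, h4, inv_mul_cancel_left₀ h0.ne']

theorem mulL_mulL_recip (a : Linf l) (ha : 0 < essInf a (leb l))
    (hpos : ∀ᵐ y ∂(leb l), 0 < a y) (u : L2 l) : mulL a (mulL (recip a ha) u) = u := by
  refine Lp.ext ?_
  filter_upwards [hpos, coeFn_mulL a (mulL (recip a ha) u), coeFn_mulL (recip a ha) u,
    (memLp_inv a ha).coeFn_toLp] with y h0 h1 h2 h3
  have h4 : (recip a ha) y = (a y)⁻¹ := h3
  rw [h1, h2, h4, mul_inv_cancel_left₀ h0.ne']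

theorem Linf_ae_abs_le (a : Linf l) : ∀ᵐ y ∂(leb l), |a y| ≤ ‖a‖ := by
  have h := ae_le_eLpNormEssSup (f := (a : ℝ → ℝ)) (μ := leb l)
  have hne : eLpNormEssSup (a : ℝ → ℝ) (leb l) ≠ ⊤ := by
    rw [← eLpNorm_exponent_top]
    exact Lp.eLpNorm_ne_top a
  filter_upwards [h] with y hy
  rw [Lp.norm_def, eLpNorm_exponent_top, ← Real.norm_eq_abs, ← toReal_enorm]
  exact ENNReal.toReal_mono hne hy

theorem ae_le_essSup_Linf (a : Linf l) : ∀ᵐ y ∂(leb l), a y ≤ essSup a (leb l) :=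
  ae_le_essSup ⟨‖a‖, (Linf_ae_abs_le a).mono fun _ h => (abs_le.1 h).2⟩

theorem ae_essInf_le_Linf (a : Linf l) : ∀ᵐ y ∂(leb l), essInf a (leb l) ≤ a y :=
  ae_essInf_le ⟨-‖a‖, (Linf_ae_abs_le a).mono fun _ h => (abs_le.1 h).1⟩

theorem ae_essInf_mul_le_Linf (a b : Linf l) :
    ∀ᵐ y ∂(leb l), essInf (fun y => a y * b y) (leb l) ≤ a y * b y := by
  refine ae_essInf_le ⟨-(‖a‖ * ‖b‖), ?_⟩
  rw [eventually_map]
  filter_upwards [Linf_ae_abs_le a, Linf_ae_abs_le b] with y h1 h2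
  have := mul_le_mul h1 h2 (abs_nonneg _) (norm_nonneg _)
  rw [← abs_mul] at this
  exact (abs_le.1 this).1

theorem leb_ne_bot (hl : 0 < l) : (ae (leb l)).NeBot := by
  rw [ae_neBot, Ne, Measure.restrict_eq_zero, Real.volume_Ioo]
  simpa using hl

theorem essInf_le_essSup_Linf (hl : 0 < l) (a : Linf l) :
    essInf a (leb l) ≤ essSup a (leb l) := by
  have := leb_ne_bot hl
  obtain ⟨y, h1, h2⟩ := ((ae_essInf_le_Linf a).and (ae_le_essSup_Linf a)).exists
  exact h1.trans h2

theorem essInf_mul_pos (hl : 0 < l) {a b : Linf l} (ha : 0 < essInf a (leb l))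
    (hb : 0 < essInf b (leb l)) : 0 < essInf (fun y => a y * b y) (leb l) := by
  have := leb_ne_bot hl
  refine (mul_pos ha hb).trans_le (le_essInf_of_ae_le _ ?_ ?_)
  · filter_upwards [ae_essInf_le_Linf a, ae_essInf_le_Linf b] with y h1 h2
    exact mul_le_mul h1 h2 hb.le (ha.le.trans h1)
  · refine IsBoundedUnder.isCoboundedUnder_ge ⟨‖a‖ * ‖b‖, ?_⟩
    rw [eventually_map]
    filter_upwards [Linf_ae_abs_le a, Linf_ae_abs_le b] with y h1 h2
    have := mul_le_mul h1 h2 (abs_nonneg _) (norm_nonneg _)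
    rw [← abs_mul] at this
    exact (abs_le.1 this).2

theorem le_inner_mulL_self {a : Linf l} {m : ℝ} (h : ∀ᵐ y ∂(leb l), m ≤ a y) (u : L2 l) :
    m * ‖u‖ ^ 2 ≤ ⟪mulL a u, u⟫ := by
  rw [← real_inner_self_eq_norm_sq, L2_inner_eq, inner_mulL, ← integral_const_mul]
  refine integral_mono_ae ((integrable_L2_mul u u).const_mul m) (integrable_mulL a u u) ?_
  filter_upwards [h] with y hy
  nlinarith [mul_self_nonneg (u y)]

theorem inner_mulL_self_le {a : Linf l} {m : ℝ} (h : ∀ᵐ y ∂(leb l), a y ≤ m) (u : L2 l) :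
    ⟪mulL a u, u⟫ ≤ m * ‖u‖ ^ 2 := by
  rw [← real_inner_self_eq_norm_sq, inner_mulL, L2_inner_eq, ← integral_const_mul]
  refine integral_mono_ae (integrable_mulL a u u) ((integrable_L2_mul u u).const_mul m) ?_
  filter_upwards [h] with y hy
  nlinarith [mul_self_nonneg (u y)]

/-- The form of a at u + tv is nonnegative for every t. Take t = ±√R, bound ⟪au, u⟫ by R‖u‖² and
divide by √R. -/
theorem abs_two_mul_inner_mulL_le {a : Linf l} {R : ℝ} (hR : 0 < R)
    (h0 : ∀ᵐ y ∂(leb l), 0 ≤ a y) (h : ∀ᵐ y ∂(leb l), a y ≤ R) (u v : L2 l) :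
    |2 * ⟪mulL a u, v⟫| ≤ √R * (‖u‖ ^ 2 + ⟪mulL a v, v⟫) := by
  have hs : 0 < √R := Real.sqrt_pos.2 hR
  have hsq : √R * √R = R := Real.mul_self_sqrt hR.le
  have key : ∀ t : ℝ, 0 ≤ ⟪mulL a u, u⟫ + 2 * t * ⟪mulL a u, v⟫ + t ^ 2 * ⟪mulL a v, v⟫ := by
    intro t
    have h1 := le_inner_mulL_self h0 (u + t • v)
    rw [mulL_add, mulL_smul, inner_add_left, inner_add_right, inner_add_right,
      real_inner_smul_right, real_inner_smul_left, real_inner_smul_left, real_inner_smul_right,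
      inner_mulL_comm a v u] at h1
    linarith
  have h1 := inner_mulL_self_le h u
  have h2 := key (√R)
  have h3 := key (-√R)
  rw [abs_le]
  constructor
  · refine le_of_mul_le_mul_left ?_ hs
    nlinarith
  · refine le_of_mul_le_mul_left ?_ hs
    nlinarith

/-- Young's inequality for a damped beam: the Kelvin–Voigt dissipation controls the mixed term. -/
theorem damping_estimate {E η : Linf l} {ε N I : ℝ} (hε : 0 < ε)
    (hE : ∀ᵐ y ∂(leb l), 0 ≤ E y) (hN : ∀ᵐ y ∂(leb l), η y ≤ N)
    (hI : ∀ᵐ y ∂(leb l), I ≤ η y * E y) (hI0 : 0 ≤ I) (hεN : ε * N ≤ 4) (w p : L2 l) :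
    (1 - ε * N / 4) * I * ‖p‖ ^ 2 ≤
      ε * ⟪mulL E w, w⟫ + ⟪mulL η (mulL E p), p⟫ + ε * ⟪mulL η (mulL E w), p⟫ := by
  have i1 : Integrable (fun y => ε * ((mulL E w) y * w y) + (mulL η (mulL E p)) y * p y)
      (leb l) := ((integrable_L2_mul _ _).const_mul _).add (integrable_L2_mul _ _)
  rw [← real_inner_self_eq_norm_sq, L2_inner_eq, L2_inner_eq, L2_inner_eq, L2_inner_eq,
    ← integral_const_mul, ← integral_const_mul, ← integral_const_mul,
    ← integral_add ((integrable_L2_mul _ _).const_mul _) (integrable_L2_mul _ _),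
    ← integral_add i1
      ((integrable_L2_mul _ _).const_mul _)]
  refine integral_mono_ae ((integrable_L2_mul _ _).const_mul _)
    (i1.add ((integrable_L2_mul _ _).const_mul _)) ?_
  filter_upwards [hE, hN, hI, coeFn_mulL E w, coeFn_mulL η (mulL E p), coeFn_mulL E p,
    coeFn_mulL η (mulL E w)] with y h1 h2 h3 h4 h5 h6 h7
  rw [h5, h6, h7, h4]
  -- Completing the square in w leaves ηE(1 − εη/4)p². The next two facts replace η by its bound N
  -- in the bracket, then ηE by its bound I.
  have a1 : 0 ≤ ε * E y * (w y + η y * p y / 2) ^ 2 := by positivity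
  have a2 : 0 ≤ (η y * E y * (ε * (N - η y) / 4)) * (p y * p y) := by
    refine mul_nonneg (mul_nonneg (hI0.trans h3) ?_) (mul_self_nonneg _)
    have := sub_nonneg.2 h2
    positivity
  have a3 : 0 ≤ (1 - ε * N / 4) * (η y * E y - I) * (p y * p y) :=
    mul_nonneg (mul_nonneg (by linarith) (sub_nonneg.2 h3)) (mul_self_nonneg _)
  nlinarith

end Multiplication

/-! ### Coercive problems -/

section Coercive

open scoped RealInnerProductSpace

/-- Lax–Milgram for a coercive bounded operator. -/
theorem surjective_of_coercive {H : Type*} [NormedAddCommGroup H] [InnerProductSpace ℝ H]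
    [CompleteSpace H] (B : H →L[ℝ] H) {c : ℝ} (hc : 0 < c)
    (h : ∀ v, c * ‖v‖ ^ 2 ≤ ⟪B v, v⟫) : Function.Surjective B := by
  let b : H →L[ℝ] H →L[ℝ] ℝ :=
    (isBoundedBilinearMap_inner (𝕜 := ℝ) (E := H)).toContinuousLinearMap.comp B
  have hb : IsCoercive b := ⟨c, hc, fun v => by
    have := h v
    rw [sq, ← mul_assoc] at this
    exact this⟩
  intro y
  refine ⟨hb.continuousLinearEquivOfBilin.symm y, ?_⟩
  rw [hb.unique_continuousLinearEquivOfBilin (v := hb.continuousLinearEquivOfBilin.symm y)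
    (f := B (hb.continuousLinearEquivOfBilin.symm y)) (fun _ => rfl)]
  exact hb.continuousLinearEquivOfBilin.apply_symm_apply y

variable {l : ℝ}

/-- Solvability of the variational problem behind the resolvent equation of a damped beam. -/
theorem exists_resolvent_solution {E η r : Linf l} {I : ℝ} (hI : 0 < I)
    (hE : ∀ᵐ y ∂(leb l), 0 ≤ E y) (hr : ∀ᵐ y ∂(leb l), 0 ≤ r y)
    (hηE : ∀ᵐ y ∂(leb l), I ≤ η y * E y) (K : L2 l →L[ℝ] L2 l) (e : L2 l) {k ε s : ℝ}
    (hk : 0 ≤ k) (hε : 0 < ε) (hs : 0 < s) (a b : L2 l) :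
    ∃ p : L2 l, mulL E (s⁻¹ • (p + a)) + mulL η (mulL E p)
      = K.adjoint (mulL r (b - s • K p)) - (k * ⟪e, p + ε • s⁻¹ • (p + a)⟫) • e := by
  -- Here p is the top derivative of the velocity, Kp the velocity, and w = s⁻¹(p + a) the strain
  -- from the first resolvent equation; the second gives G = r(b − sKp). B collects the terms linear
  -- in p. Coercivity comes from ηE alone, the other terms being nonnegative.
  let B : L2 l →L[ℝ] L2 l := s⁻¹ • mulOp E + (mulOp η).comp (mulOp E)
    + s • K.adjoint.comp ((mulOp r).comp K)
    + (k * (1 + ε * s⁻¹)) • (innerSL ℝ e).smulRight e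
  have hB : ∀ v, B v = s⁻¹ • mulL E v + mulL η (mulL E v) + s • K.adjoint (mulL r (K v))
      + (k * (1 + ε * s⁻¹)) • (⟪e, v⟫ • e) := fun v => rfl
  have hcoer : ∀ v, I * ‖v‖ ^ 2 ≤ ⟪B v, v⟫ := by
    intro v
    have h1 := le_inner_mulL_self hE v
    have h2 : I * ‖v‖ ^ 2 ≤ ⟪mulL η (mulL E v), v⟫ := by
      rw [← real_inner_self_eq_norm_sq, L2_inner_eq, L2_inner_eq, ← integral_const_mul]
      refine integral_mono_ae ((integrable_L2_mul v v).const_mul I) (integrable_L2_mul _ v) ?_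
      filter_upwards [hηE, coeFn_mulL η (mulL E v), coeFn_mulL E v] with y h3 h4 h5
      rw [h4, h5]
      nlinarith [mul_self_nonneg (v y)]
    have h3 := le_inner_mulL_self hr (K v)
    rw [zero_mul] at h1 h3
    rw [hB, inner_add_left, inner_add_left, inner_add_left, real_inner_smul_left,
      real_inner_smul_left, ContinuousLinearMap.adjoint_inner_left, real_inner_smul_left,
      real_inner_smul_left]
    have h4 : 0 ≤ s⁻¹ * ⟪mulL E v, v⟫ := by positivity
    have h5 : 0 ≤ s * ⟪mulL r (K v), K v⟫ := by positivity
    have h6 : 0 ≤ (k * (1 + ε * s⁻¹)) * (⟪e, v⟫ * ⟪e, v⟫) :=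
      mul_nonneg (by positivity) (mul_self_nonneg _)
    linarith
  obtain ⟨p, hp⟩ := surjective_of_coercive B hI hcoer
    (K.adjoint (mulL r b) - s⁻¹ • mulL E a - (k * (ε * s⁻¹ * ⟪e, a⟫)) • e)
  refine ⟨p, ?_⟩
  rw [hB] at hp
  have e1 : mulL r (b - s • K p) = mulL r b - s • mulL r (K p) := by
    simp only [← mulOp_apply, map_sub, map_smul]
  rw [e1, map_sub, map_smul, mulL_smul, mulL_add, smul_add, inner_add_right, real_inner_smul_right,
    real_inner_smul_right, inner_add_right]
  rw [← sub_eq_zero] at hp ⊢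
  rw [← hp]
  simp only [smul_smul]
  module

end Coercive

/-! ### Vector spaces with a prescribed inner product -/

section Cores

variable {V : Type*} [AddCommGroup V] [Module ℝ V]

/-- The inner product given by a symmetric positive definite bilinear form. -/
abbrev coreOfForm (b : V → V → ℝ) (hsymm : ∀ x y, b x y = b y x)
    (hadd : ∀ x y z, b (x + y) z = b x z + b y z) (hsmul : ∀ (c : ℝ) x y, b (c • x) y = c * b x y)
    (hnonneg : ∀ x, 0 ≤ b x x) (hdef : ∀ x, b x x = 0 → x = 0) : InnerProductSpace.Core ℝ V where
  inner := b
  conj_inner_symm x y := hsymm y x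
  re_inner_nonneg x := hnonneg x
  add_left := hadd
  smul_left x y c := hsmul c x y
  definite := hdef

/-- An inner product whose norm is equivalent to a complete one is complete. -/
theorem isHilbert_of_equiv {W : Type*} [NormedAddCommGroup W] [NormedSpace ℝ W] [CompleteSpace W]
    (c : InnerProductSpace.Core ℝ V) (Φ : V ≃ₗ[ℝ] W) {C D : ℝ}
    (hC : ∀ x, c.inner x x ≤ C * ‖Φ x‖ ^ 2) (hD : ∀ x, ‖Φ x‖ ^ 2 ≤ D * c.inner x x) :
    IsHilbert c := by
  let _ : NormedAddCommGroup V := c.toNormedAddCommGroup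
  let _ : InnerProductSpace ℝ V := InnerProductSpace.ofCore c.toCore
  have hn : ∀ x : V, c.inner x x = ‖x‖ ^ 2 := fun x => real_inner_self_eq_norm_sq x
  have h1 : ∀ x : V, ‖Φ x‖ ≤ √|D| * ‖x‖ := fun x => by
    refine (pow_le_pow_iff_left₀ (norm_nonneg _) (by positivity) two_ne_zero).1 ?_
    rw [mul_pow, Real.sq_sqrt (abs_nonneg D)]
    refine (hD x).trans ?_
    rw [hn]
    gcongr
    exact le_abs_self D
  have h2 : ∀ y : W, ‖Φ.symm y‖ ≤ √|C| * ‖y‖ := fun y => by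
    refine (pow_le_pow_iff_left₀ (norm_nonneg _) (by positivity) two_ne_zero).1 ?_
    rw [mul_pow, Real.sq_sqrt (abs_nonneg C), ← hn]
    refine (hC _).trans ?_
    rw [Φ.apply_symm_apply]
    gcongr
    exact le_abs_self C
  let e : V ≃L[ℝ] W := Φ.toContinuousLinearEquivOfBounds _ _ h1 h2
  exact (completeSpace_congr (e := e.toEquiv) e.isUniformEmbedding).2 inferInstance

theorem isDenseIn_iff (c : InnerProductSpace.Core ℝ V) (S : Set V) :
    IsDenseIn c S ↔ ∀ x, ∀ ε : ℝ, 0 < ε → ∃ s ∈ S, c.inner (x - s) (x - s) < ε ^ 2 := by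
  let _ : NormedAddCommGroup V := c.toNormedAddCommGroup
  let _ : InnerProductSpace ℝ V := InnerProductSpace.ofCore c.toCore
  have hn : ∀ x : V, c.inner x x = ‖x‖ ^ 2 := fun x => real_inner_self_eq_norm_sq x
  have h : IsDenseIn c S ↔ ∀ x, ∀ ε > 0, ∃ s ∈ S, dist x s < ε :=
    forall_congr' fun x => Metric.mem_closure_iff
  rw [h]
  refine forall₃_congr fun x ε hε => exists_congr fun s => and_congr_right fun _ => ?_
  rw [hn, pow_lt_pow_iff_left₀ (norm_nonneg _) hε.le two_ne_zero, dist_eq_norm]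

theorem IsDenseIn.of_le {c c' : InnerProductSpace.Core ℝ V} {S : Set V} {C : ℝ} (hC : 0 < C)
    (h : ∀ x, c.inner x x ≤ C * c'.inner x x) (hS : IsDenseIn c' S) : IsDenseIn c S := by
  rw [isDenseIn_iff] at hS ⊢
  intro x ε hε
  obtain ⟨s, hs, hlt⟩ := hS x (ε / √C) (by positivity)
  refine ⟨s, hs, (h _).trans_lt ?_⟩
  rw [div_pow, Real.sq_sqrt hC.le, lt_div_iff₀ hC] at hlt
  linarith

theorem generatesC0ContractionsOn_of_dissipative (c : InnerProductSpace.Core ℝ V)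
    (hc : IsHilbert c) {A : V →ₗ.[ℝ] V} (hA : ∀ x : A.domain, c.inner (A x) (x : V) ≤ 0)
    (hsurj : ∀ r : ℝ, 0 < r → ∀ y : V, ∃ x : A.domain, r • (x : V) - A x = y) :
    GeneratesC0ContractionsOn c A := by
  let _ : NormedAddCommGroup V := c.toNormedAddCommGroup
  let _ : InnerProductSpace ℝ V := InnerProductSpace.ofCore c.toCore
  have _ : CompleteSpace V := hc
  exact generates_of_dissipative hA hsurj

theorem isDenseIn_domain_of_dissipative (c : InnerProductSpace.Core ℝ V)
    (hc : IsHilbert c) {A : V →ₗ.[ℝ] V} (hA : ∀ x : A.domain, c.inner (A x) (x : V) ≤ 0)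
    (hsurj : ∀ y : V, ∃ x : A.domain, (x : V) - A x = y) :
    IsDenseIn c (A.domain : Set V) := by
  let _ : NormedAddCommGroup V := c.toNormedAddCommGroup
  let _ : InnerProductSpace ℝ V := InnerProductSpace.ofCore c.toCore
  have _ : CompleteSpace V := hc
  exact dense_domain_of_dissipative hA hsurj

end Cores

/-! ### Energy and dissipation estimates -/

section Estimates

open scoped RealInnerProductSpace

variable {l : ℝ}

/-- `hf` is a Poincaré inequality, which turns √R‖f‖² into at most (κ√R/m)⟪Ew, w⟫. The two lower
bounds on C are the two entries of `Km` belonging to one of the motions. -/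
theorem cross_term_estimate {E r : Linf l} {m R κ C : ℝ} (hm : 0 < m) (hR : 0 < R)
    (hE : ∀ᵐ y ∂(leb l), m ≤ E y) (hr : ∀ᵐ y ∂(leb l), 0 ≤ r y) (hrR : ∀ᵐ y ∂(leb l), r y ≤ R)
    (hC1 : √R ≤ C) (hC2 : κ * √R / m ≤ C) {f w g : L2 l} (hf : ‖f‖ ^ 2 ≤ κ * ‖w‖ ^ 2) :
    |2 * ⟪mulL r f, g⟫| ≤ C * (⟪mulL E w, w⟫ + ⟪mulL r g, g⟫) := by
  have h1 := abs_two_mul_inner_mulL_le hR hr hrR f g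
  have h2 := le_inner_mulL_self hE w
  have h3 := le_inner_mulL_self hr g
  rw [zero_mul] at h3
  have h4 : √R * ‖f‖ ^ 2 ≤ C * ⟪mulL E w, w⟫ := by
    calc √R * ‖f‖ ^ 2 ≤ √R * (κ * ‖w‖ ^ 2) := by gcongr
      _ = (κ * √R / m) * (m * ‖w‖ ^ 2) := by field_simp
      _ ≤ C * (m * ‖w‖ ^ 2) := by gcongr
      _ ≤ C * ⟪mulL E w, w⟫ := by
        have : 0 ≤ C := (Real.sqrt_nonneg R).trans hC1
        gcongr
  have h5 := mul_le_mul_of_nonneg_right hC1 h3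
  linarith

/-- The left side is the bending or torsional half of ⟨AX, X⟩₂, with velocity Kp, displacement Kw,
and −G the density times the acceleration. Pairing `hM` with p + εw cancels ⟪Ep, w⟫ and turns the
feedback into −k⟪e, p + εw⟫²; this is why the feedback contains the displacement with the same ε as
the inner product. `hsmall` lets the damping absorb ε⟪rKp, Kp⟫. -/
theorem dissipation_estimate {E η r : Linf l} {ε N I R κ k : ℝ} (hε : 0 < ε) (hk : 0 ≤ k)
    (hE : ∀ᵐ y ∂(leb l), 0 ≤ E y) (hN : ∀ᵐ y ∂(leb l), η y ≤ N)
    (hI : ∀ᵐ y ∂(leb l), I ≤ η y * E y) (hI0 : 0 ≤ I) (hεN : ε * N ≤ 4)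
    (hrR : ∀ᵐ y ∂(leb l), r y ≤ R) (hR : 0 ≤ R)
    (hsmall : ε * (R * κ) ≤ (1 - ε * N / 4) * I)
    {K : L2 l →L[ℝ] L2 l} (hK : ∀ u, ‖K u‖ ^ 2 ≤ κ * ‖u‖ ^ 2) {e w p G : L2 l}
    (hM : mulL E w + mulL η (mulL E p) = K.adjoint G - (k * ⟪e, p + ε • w⟫) • e) :
    ⟪mulL E p, w⟫ - ⟪G, K p⟫ + ε * (⟪mulL r (K p), K p⟫ - ⟪G, K w⟫) ≤ 0 := by
  have h1 := congrArg (fun u => ⟪u, p + ε • w⟫) hM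
  simp only [inner_sub_left, ContinuousLinearMap.adjoint_inner_left, real_inner_smul_left,
    map_add, map_smul] at h1
  simp only [inner_add_left, inner_add_right, real_inner_smul_right] at h1
  have hD : ⟪mulL η (mulL E p), w⟫ = ⟪mulL η (mulL E w), p⟫ := by
    rw [L2_inner_eq, L2_inner_eq]
    refine integral_congr_ae ?_
    filter_upwards [coeFn_mulL η (mulL E p), coeFn_mulL E p, coeFn_mulL η (mulL E w),
      coeFn_mulL E w] with y h2 h3 h4 h5
    rw [h2, h3, h4, h5]
    ring
  have h2 := damping_estimate hε hE hN hI hI0 hεN w p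
  have h3 := inner_mulL_self_le hrR (K p)
  have h4 : R * ‖K p‖ ^ 2 ≤ R * (κ * ‖p‖ ^ 2) := mul_le_mul_of_nonneg_left (hK p) hR
  have h5 : ε * ⟪mulL r (K p), K p⟫ ≤ ε * (R * κ) * ‖p‖ ^ 2 := by
    rw [mul_assoc]
    refine mul_le_mul_of_nonneg_left ?_ hε.le
    linarith
  have h6 := mul_le_mul_of_nonneg_right hsmall (sq_nonneg ‖p‖)
  have h7 : 0 ≤ k * (⟪e, p⟫ + ε * ⟪e, w⟫) * (⟪e, p⟫ + ε * ⟪e, w⟫) := by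
    rw [mul_assoc]
    exact mul_nonneg hk (mul_self_nonneg _)
  have h8 := inner_mulL_comm E p w
  rw [hD] at h1
  linarith

end Estimates

/-! ### The wing operator -/

namespace Wing

open scoped RealInnerProductSpace

variable {P : Wing}

theorem ae_nonneg_of_essInf_pos {l : ℝ} {a : Linf l} (ha : 0 < essInf a (leb l)) :
    ∀ᵐ y ∂(leb l), 0 ≤ a y :=
  (ae_essInf_le_Linf a).mono fun _ h => ha.le.trans h

theorem ae_pos_of_essInf_pos {l : ℝ} {a : Linf l} (ha : 0 < essInf a (leb l)) :
    ∀ᵐ y ∂(leb l), 0 < a y :=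
  (ae_essInf_le_Linf a).mono fun _ h => ha.trans_le h

/-- The twofold primitive. -/
def volterraSq {l : ℝ} (hl : 0 < l) : L2 l →L[ℝ] L2 l := (volterra hl).comp (volterra hl)

theorem volterraSq_apply {l : ℝ} (hl : 0 < l) (u : L2 l) :
    volterraSq hl u = volterra hl (volterra hl u) := rfl

theorem adjoint_volterraSq_apply {l : ℝ} (hl : 0 < l) (u : L2 l) :
    (volterraSq hl).adjoint u = (volterra hl).adjoint ((volterra hl).adjoint u) := by
  rw [volterraSq, ContinuousLinearMap.adjoint_comp]
  rfl

theorem norm_sq_volterra_le {l : ℝ} (hl : 0 < l) (u : L2 l) :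
    ‖volterra hl u‖ ^ 2 ≤ (2 * l / Real.pi) ^ 2 * ‖u‖ ^ 2 := by
  rw [← mul_pow]
  exact pow_le_pow_left₀ (norm_nonneg _) (norm_volterra_le hl u) 2

theorem norm_sq_volterraSq_le {l : ℝ} (hl : 0 < l) (u : L2 l) :
    ‖volterraSq hl u‖ ^ 2 ≤ (2 * l / Real.pi) ^ 4 * ‖u‖ ^ 2 := by
  have h1 := norm_sq_volterra_le hl (volterra hl u)
  have h2 := mul_le_mul_of_nonneg_left (norm_sq_volterra_le hl u) (sq_nonneg (2 * l / Real.pi))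
  rw [volterraSq_apply]
  refine (h1.trans h2).trans (le_of_eq ?_)
  ring

theorem volterraSq_mem_H2 {l : ℝ} (hl : 0 < l) (u : L2 l) : volterraSq hl u ∈ H2 l :=
  ⟨volterra_mem_H1 hl _, by rw [volterraSq_apply, wd_volterra]; exact volterra_mem_H1 hl _⟩

theorem wd_wd_volterraSq {l : ℝ} (hl : 0 < l) (u : L2 l) : wd (wd (volterraSq hl u)) = u := by
  rw [volterraSq_apply, wd_volterra, wd_volterra]

theorem hasValueAt_volterraSq_right {l : ℝ} (hl : 0 < l) (u : L2 l) :
    HasValueAt (volterraSq hl u) l ⟪(volterra hl).adjoint (oneL2 l), u⟫ := by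
  rw [ContinuousLinearMap.adjoint_inner_left]
  exact hasValueAt_volterra_right hl _

theorem eq_volterraSq {l : ℝ} (hl : 0 < l) {u : L2 l} (hu : u ∈ H2 l) (h0 : HasValueAt u 0 0)
    (h1 : HasValueAt (wd u) 0 0) : u = volterraSq hl (wd (wd u)) := by
  rw [volterraSq_apply, ← eq_volterra_wd hl hu.2 h1]
  exact eq_volterra_wd hl hu.1 h0

/-- A bending moment is determined by its second derivative and its boundary values at the tip. -/
theorem eq_adjoint_volterraSq {l : ℝ} (hl : 0 < l) {M : L2 l} (hM : M ∈ H2 l) {c : ℝ}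
    (h0 : HasValueAt M l 0) (h1 : HasValueAt (wd M) l c) :
    M = (volterraSq hl).adjoint (wd (wd M)) - c • (volterra hl).adjoint (oneL2 l) := by
  have e1 := eq_const_sub_adjoint_wd hl hM.1 h0
  have e2 := eq_const_sub_adjoint_wd hl hM.2 h1
  rw [adjoint_volterraSq_apply]
  nth_rewrite 1 [e1]
  nth_rewrite 1 [e2]
  rw [map_sub, map_smul, zero_smul]
  abel

/-! ### Curvature and twist rate as coordinates on the state space -/

namespace State

/-- bending curvature -/
def curv (X : P.State) : L2 P.l := wd (wd X.f)

/-- twist rate -/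
def twist (X : P.State) : L2 P.l := wd X.h

theorem curv_add (X Y : P.State) : (X + Y).curv = X.curv + Y.curv := wd2_add X.f_mem Y.f_mem
theorem curv_smul (c : ℝ) (X : P.State) : (c • X).curv = c • X.curv := wd2_smul c X.f_mem
theorem twist_add (X Y : P.State) : (X + Y).twist = X.twist + Y.twist := wd_add X.h_mem Y.h_mem
theorem twist_smul (c : ℝ) (X : P.State) : (c • X).twist = c • X.twist := wd_smul c X.h_mem

theorem f_eq (X : P.State) : X.f = volterraSq P.l_pos X.curv :=
  eq_volterraSq P.l_pos X.f_mem X.2.2.2.1 X.2.2.2.2.1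

theorem h_eq (X : P.State) : X.h = volterra P.l_pos X.twist :=
  eq_volterra_wd P.l_pos X.h_mem X.2.2.2.2.2

/-- The state with given curvature, bending velocity, twist rate and twisting velocity. -/
def mk' (w g v z : L2 P.l) : P.State :=
  ⟨(volterraSq P.l_pos w, g, volterra P.l_pos v, z), volterraSq_mem_H2 P.l_pos w,
    volterra_mem_H1 P.l_pos v, hasValueAt_volterra_left P.l_pos _, by
      rw [volterraSq_apply, wd_volterra]; exact hasValueAt_volterra_left P.l_pos _,
    hasValueAt_volterra_left P.l_pos v⟩

theorem curv_mk' (w g v z : L2 P.l) : (mk' w g v z).curv = w := wd_wd_volterraSq P.l_pos w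
theorem g_mk' (w g v z : L2 P.l) : (mk' w g v z).g = g := rfl
theorem twist_mk' (w g v z : L2 P.l) : (mk' w g v z).twist = v := wd_volterra P.l_pos v
theorem z_mk' (w g v z : L2 P.l) : (mk' w g v z).z = z := rfl

theorem ext' {X Y : P.State} (hw : X.curv = Y.curv) (hg : X.g = Y.g) (hv : X.twist = Y.twist)
    (hz : X.z = Y.z) : X = Y :=
  State.ext (by rw [X.f_eq, Y.f_eq, hw]) hg (by rw [X.h_eq, Y.h_eq, hv]) hz

/-- A state is given by four square integrable functions: curvature, bending velocity,
twist rate and twisting velocity. -/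
def equivL2 : P.State ≃ₗ[ℝ] L2 P.l × L2 P.l × L2 P.l × L2 P.l where
  toFun X := (X.curv, X.g, X.twist, X.z)
  invFun U := mk' U.1 U.2.1 U.2.2.1 U.2.2.2
  map_add' X Y := by rw [curv_add, twist_add]; rfl
  map_smul' c X := by rw [curv_smul, twist_smul]; rfl
  left_inv X := ext' (curv_mk' _ _ _ _) rfl (twist_mk' _ _ _ _) rfl
  right_inv U := by simp only [curv_mk', g_mk', twist_mk', z_mk']

end State

/-! ### The two energy forms and their equivalence -/

theorem inner₁_eq (X Y : P.State) : inner₁ X Y =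
    (⟪mulL P.EI X.curv, Y.curv⟫ + ⟪mulL P.ρ X.g, Y.g⟫)
      + (⟪mulL P.GJ X.twist, Y.twist⟫ + ⟪mulL P.Iw X.z, Y.z⟫) := by
  simp only [inner_mulL]
  rw [← integral_add (integrable_mulL _ _ _) (integrable_mulL _ _ _),
    ← integral_add (integrable_mulL _ _ _) (integrable_mulL _ _ _)]
  rfl

theorem inner₂_eq (ε₁ ε₂ : ℝ) (X Y : P.State) : inner₂ ε₁ ε₂ X Y =
    inner₁ X Y + ε₁ * (⟪mulL P.ρ X.f, Y.g⟫ + ⟪mulL P.ρ X.g, Y.f⟫)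
      + ε₂ * (⟪mulL P.Iw X.h, Y.z⟫ + ⟪mulL P.Iw X.z, Y.h⟫) := by
  simp only [inner_mulL]
  rw [← integral_add (integrable_mulL _ _ _) (integrable_mulL _ _ _),
    ← integral_add (integrable_mulL _ _ _) (integrable_mulL _ _ _)]
  simp only [inner₂, mul_add, mul_assoc]

theorem inner₁_comm (X Y : P.State) : inner₁ X Y = inner₁ Y X := by
  rw [inner₁_eq, inner₁_eq, inner_mulL_comm P.EI, inner_mulL_comm P.ρ, inner_mulL_comm P.GJ,
    inner_mulL_comm P.Iw]

theorem essSup_ρ_pos (P : Wing) : 0 < essSup P.ρ (leb P.l) :=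
  P.ρ_pos.trans_le (essInf_le_essSup_Linf P.l_pos _)

theorem essSup_Iw_pos (P : Wing) : 0 < essSup P.Iw (leb P.l) :=
  P.Iw_pos.trans_le (essInf_le_essSup_Linf P.l_pos _)

theorem essSup_ηω_pos (P : Wing) : 0 < essSup P.ηω (leb P.l) :=
  P.ηω_pos.trans_le (essInf_le_essSup_Linf P.l_pos _)

theorem essSup_ηφ_pos (P : Wing) : 0 < essSup P.ηφ (leb P.l) :=
  P.ηφ_pos.trans_le (essInf_le_essSup_Linf P.l_pos _)

theorem infηEI_pos (P : Wing) : 0 < P.infηEI := essInf_mul_pos P.l_pos P.ηω_pos P.EI_pos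

theorem infηGJ_pos (P : Wing) : 0 < P.infηGJ := essInf_mul_pos P.l_pos P.ηφ_pos P.GJ_pos

theorem Km_pos (P : Wing) : 0 < P.Km :=
  (Real.sqrt_pos.2 P.essSup_ρ_pos).trans_le ((le_max_left _ _).trans (le_max_left _ _))

theorem abs_bending_cross_le (X : P.State) : |2 * ⟪mulL P.ρ X.f, X.g⟫| ≤
    P.Km * (⟪mulL P.EI X.curv, X.curv⟫ + ⟪mulL P.ρ X.g, X.g⟫) := by
  refine cross_term_estimate (κ := (2 * P.l / Real.pi) ^ 4) P.EI_pos P.essSup_ρ_pos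
    (ae_essInf_le_Linf _) (ae_nonneg_of_essInf_pos P.ρ_pos) (ae_le_essSup_Linf _)
    ((le_max_left _ _).trans (le_max_left _ _)) ?_ ?_
  · refine le_trans (le_of_eq ?_) ((le_max_right _ _).trans (le_max_left _ _))
    have := P.EI_pos.ne'
    field_simp
    ring
  · rw [X.f_eq]
    exact norm_sq_volterraSq_le P.l_pos _

theorem abs_torsion_cross_le (X : P.State) : |2 * ⟪mulL P.Iw X.h, X.z⟫| ≤
    P.Km * (⟪mulL P.GJ X.twist, X.twist⟫ + ⟪mulL P.Iw X.z, X.z⟫) := by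
  refine cross_term_estimate (κ := (2 * P.l / Real.pi) ^ 2) P.GJ_pos P.essSup_Iw_pos
    (ae_essInf_le_Linf _) (ae_nonneg_of_essInf_pos P.Iw_pos) (ae_le_essSup_Linf _)
    ((le_max_left _ _).trans (le_max_right _ _)) ?_ ?_
  · refine le_trans (le_of_eq ?_) ((le_max_right _ _).trans (le_max_right _ _))
    have := P.GJ_pos.ne'
    field_simp
    ring
  · rw [X.h_eq]
    exact norm_sq_volterra_le P.l_pos _

theorem bending_energy_nonneg (X : P.State) :
    0 ≤ ⟪mulL P.EI X.curv, X.curv⟫ + ⟪mulL P.ρ X.g, X.g⟫ := by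
  have h1 := le_inner_mulL_self (ae_nonneg_of_essInf_pos P.EI_pos) X.curv
  have h2 := le_inner_mulL_self (ae_nonneg_of_essInf_pos P.ρ_pos) X.g
  linarith

theorem torsion_energy_nonneg (X : P.State) :
    0 ≤ ⟪mulL P.GJ X.twist, X.twist⟫ + ⟪mulL P.Iw X.z, X.z⟫ := by
  have h1 := le_inner_mulL_self (ae_nonneg_of_essInf_pos P.GJ_pos) X.twist
  have h2 := le_inner_mulL_self (ae_nonneg_of_essInf_pos P.Iw_pos) X.z
  linarith

theorem inner₁_self_nonneg (X : P.State) : 0 ≤ inner₁ X X := by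
  rw [inner₁_eq]
  exact add_nonneg (bending_energy_nonneg X) (torsion_energy_nonneg X)

/-- On the diagonal the forms differ by ε₁ and ε₂ times the doubled cross terms, each at most `Km`
times its share of the energy. A common θ < 1 later serves for both definiteness and completeness.
-/
theorem abs_inner₂_sub_inner₁_le {ε₁ ε₂ θ : ℝ} (hε₁ : 0 < ε₁) (hε₂ : 0 < ε₂)
    (h₁ : ε₁ * P.Km ≤ θ) (h₂ : ε₂ * P.Km ≤ θ) (X : P.State) :
    |inner₂ ε₁ ε₂ X X - inner₁ X X| ≤ θ * inner₁ X X := by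
  have e : inner₂ ε₁ ε₂ X X - inner₁ X X
      = ε₁ * (2 * ⟪mulL P.ρ X.f, X.g⟫) + ε₂ * (2 * ⟪mulL P.Iw X.h, X.z⟫) := by
    rw [inner₂_eq, inner_mulL_comm P.ρ X.g, inner_mulL_comm P.Iw X.z]
    ring
  have b1 := mul_le_mul_of_nonneg_left (abs_bending_cross_le X) hε₁.le
  have b2 := mul_le_mul_of_nonneg_left (abs_torsion_cross_le X) hε₂.le
  have b3 := mul_le_mul_of_nonneg_right h₁ (bending_energy_nonneg X)
  have b4 := mul_le_mul_of_nonneg_right h₂ (torsion_energy_nonneg X)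
  rw [e, inner₁_eq]
  refine (abs_add_le _ _).trans ?_
  rw [abs_mul ε₁, abs_mul ε₂, abs_of_pos hε₁, abs_of_pos hε₂]
  linarith

theorem exists_norm_sq_equivL2_le (P : Wing) :
    ∃ D : ℝ, 0 < D ∧ ∀ X : P.State, ‖State.equivL2 X‖ ^ 2 ≤ D * inner₁ X X := by
  set m := min (min (essInf P.EI (leb P.l)) (essInf P.ρ (leb P.l)))
    (min (essInf P.GJ (leb P.l)) (essInf P.Iw (leb P.l))) with hm_def
  have hm : 0 < m := lt_min (lt_min P.EI_pos P.ρ_pos) (lt_min P.GJ_pos P.Iw_pos)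
  have aux : ∀ {a : Linf P.l}, m ≤ essInf a (leb P.l) → ∀ u, m * ‖u‖ ^ 2 ≤ ⟪mulL a u, u⟫ :=
    fun {a} h u => le_inner_mulL_self ((ae_essInf_le_Linf a).mono fun _ h' => h.trans h') u
  refine ⟨m⁻¹, inv_pos.2 hm, fun X => ?_⟩
  have h1 := aux ((min_le_left _ _).trans (min_le_left _ _)) X.curv
  have h2 := aux ((min_le_left _ _).trans (min_le_right _ _)) X.g
  have h3 := aux ((min_le_right _ _).trans (min_le_left _ _)) X.twist
  have h4 := aux ((min_le_right _ _).trans (min_le_right _ _)) X.z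
  have p1 : 0 ≤ m * ‖X.curv‖ ^ 2 := by positivity
  have p2 : 0 ≤ m * ‖X.g‖ ^ 2 := by positivity
  have p3 : 0 ≤ m * ‖X.twist‖ ^ 2 := by positivity
  have p4 : 0 ≤ m * ‖X.z‖ ^ 2 := by positivity
  rw [← div_eq_inv_mul, le_div_iff₀' hm, inner₁_eq]
  -- The product norm is a maximum, so it is enough to bound whichever component attains it.
  have hn : ‖State.equivL2 X‖ = max ‖X.curv‖ (max ‖X.g‖ (max ‖X.twist‖ ‖X.z‖)) := rfl
  rw [hn]
  rcases max_choice ‖X.curv‖ (max ‖X.g‖ (max ‖X.twist‖ ‖X.z‖)) with h | h <;> rw [h]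
  · linarith
  rcases max_choice ‖X.g‖ (max ‖X.twist‖ ‖X.z‖) with h | h <;> rw [h]
  · linarith
  rcases max_choice ‖X.twist‖ ‖X.z‖ with h | h <;> rw [h] <;> linarith

theorem exists_inner₁_le_norm_sq (P : Wing) :
    ∃ C : ℝ, 0 < C ∧ ∀ X : P.State, inner₁ X X ≤ C * ‖State.equivL2 X‖ ^ 2 := by
  have aux : ∀ (a : Linf P.l) u, ⟪mulL a u, u⟫ ≤ ‖a‖ * ‖u‖ ^ 2 := fun a u =>
    inner_mulL_self_le ((Linf_ae_abs_le a).mono fun _ h => (abs_le.1 h).2) u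
  refine ⟨‖P.EI‖ + ‖P.ρ‖ + ‖P.GJ‖ + ‖P.Iw‖ + 1, by positivity, fun X => ?_⟩
  have hn : ‖State.equivL2 X‖ = max ‖X.curv‖ (max ‖X.g‖ (max ‖X.twist‖ ‖X.z‖)) := rfl
  set n := ‖State.equivL2 X‖
  have aux' : ∀ (a : Linf P.l) u, ‖u‖ ≤ n → ⟪mulL a u, u⟫ ≤ ‖a‖ * n ^ 2 := fun a u h =>
    (aux a u).trans (by gcongr)
  have h1 := aux' P.EI X.curv (by rw [hn]; simp)
  have h2 := aux' P.ρ X.g (by rw [hn]; simp)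
  have h3 := aux' P.GJ X.twist (by rw [hn]; simp)
  have h4 := aux' P.Iw X.z (by rw [hn]; simp)
  rw [inner₁_eq]
  nlinarith [sq_nonneg n]

theorem inner₁_add_left (X Y Z : P.State) : inner₁ (X + Y) Z = inner₁ X Z + inner₁ Y Z := by
  simp only [inner₁_eq, State.curv_add, State.g_add, State.twist_add, State.z_add, mulL_add,
    inner_add_left]
  ring

theorem inner₁_smul_left (c : ℝ) (X Y : P.State) : inner₁ (c • X) Y = c * inner₁ X Y := by
  simp only [inner₁_eq, State.curv_smul, State.g_smul, State.twist_smul, State.z_smul, mulL_smul,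
    real_inner_smul_left]
  ring

theorem inner₂_comm (ε₁ ε₂ : ℝ) (X Y : P.State) : inner₂ ε₁ ε₂ X Y = inner₂ ε₁ ε₂ Y X := by
  rw [inner₂_eq, inner₂_eq, inner₁_comm, inner_mulL_comm P.ρ X.f, inner_mulL_comm P.ρ X.g,
    inner_mulL_comm P.Iw X.h, inner_mulL_comm P.Iw X.z]
  ring

theorem inner₂_add_left (ε₁ ε₂ : ℝ) (X Y Z : P.State) :
    inner₂ ε₁ ε₂ (X + Y) Z = inner₂ ε₁ ε₂ X Z + inner₂ ε₁ ε₂ Y Z := by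
  simp only [inner₂_eq, inner₁_add_left, State.f_add, State.g_add, State.h_add, State.z_add,
    mulL_add, inner_add_left]
  ring

theorem inner₂_smul_left (ε₁ ε₂ c : ℝ) (X Y : P.State) :
    inner₂ ε₁ ε₂ (c • X) Y = c * inner₂ ε₁ ε₂ X Y := by
  simp only [inner₂_eq, inner₁_smul_left, State.f_smul, State.g_smul, State.h_smul, State.z_smul,
    mulL_smul, real_inner_smul_left]
  ring

theorem eq_zero_of_inner₁_self_eq_zero {X : P.State} (h : inner₁ X X = 0) : X = 0 := by
  obtain ⟨D, -, hD⟩ := exists_norm_sq_equivL2_le P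
  have h1 := hD X
  rw [h, mul_zero] at h1
  have h2 : ‖State.equivL2 X‖ = 0 := by
    have := sq_nonneg ‖State.equivL2 X‖
    exact pow_eq_zero_iff two_ne_zero |>.1 (le_antisymm h1 this)
  rw [norm_eq_zero] at h2
  exact State.equivL2.map_eq_zero_iff.1 h2

variable (P) in
/-- The energy inner product. -/
abbrev core₁ : InnerProductSpace.Core ℝ P.State :=
  coreOfForm inner₁ inner₁_comm inner₁_add_left inner₁_smul_left inner₁_self_nonneg
    fun _ => eq_zero_of_inner₁_self_eq_zero

theorem inner₂_self_ge {ε₁ ε₂ θ : ℝ} (hε₁ : 0 < ε₁) (hε₂ : 0 < ε₂)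
    (h₁ : ε₁ * P.Km ≤ θ) (h₂ : ε₂ * P.Km ≤ θ) (X : P.State) :
    (1 - θ) * inner₁ X X ≤ inner₂ ε₁ ε₂ X X := by
  have := (abs_le.1 (abs_inner₂_sub_inner₁_le hε₁ hε₂ h₁ h₂ X)).1
  linarith

theorem inner₂_self_le {ε₁ ε₂ θ : ℝ} (hε₁ : 0 < ε₁) (hε₂ : 0 < ε₂)
    (h₁ : ε₁ * P.Km ≤ θ) (h₂ : ε₂ * P.Km ≤ θ) (X : P.State) :
    inner₂ ε₁ ε₂ X X ≤ (1 + θ) * inner₁ X X := by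
  have := (abs_le.1 (abs_inner₂_sub_inner₁_le hε₁ hε₂ h₁ h₂ X)).2
  linarith

/-- The modified inner product. -/
abbrev core₂ {ε₁ ε₂ θ : ℝ} (hε₁ : 0 < ε₁) (hε₂ : 0 < ε₂)
    (h₁ : ε₁ * P.Km ≤ θ) (h₂ : ε₂ * P.Km ≤ θ) (hθ : θ < 1) : InnerProductSpace.Core ℝ P.State :=
  coreOfForm (inner₂ ε₁ ε₂) (inner₂_comm ε₁ ε₂) (inner₂_add_left ε₁ ε₂) (inner₂_smul_left ε₁ ε₂)
    (fun X => (mul_nonneg (sub_nonneg.2 hθ.le) (inner₁_self_nonneg X)).trans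
      (inner₂_self_ge hε₁ hε₂ h₁ h₂ X))
    fun X hX => eq_zero_of_inner₁_self_eq_zero (by
      have h := inner₂_self_ge hε₁ hε₂ h₁ h₂ X
      rw [hX] at h
      exact le_antisymm (nonpos_of_mul_nonpos_right h (sub_pos.2 hθ)) (inner₁_self_nonneg X))

theorem isHilbert_core₁ : IsHilbert P.core₁ := by
  obtain ⟨C, -, hC⟩ := exists_inner₁_le_norm_sq P
  obtain ⟨D, -, hD⟩ := exists_norm_sq_equivL2_le P
  exact isHilbert_of_equiv P.core₁ State.equivL2 hC hD

theorem isHilbert_core₂ {ε₁ ε₂ θ : ℝ} (hε₁ : 0 < ε₁) (hε₂ : 0 < ε₂)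
    (h₁ : ε₁ * P.Km ≤ θ) (h₂ : ε₂ * P.Km ≤ θ) (hθ : θ < 1) :
    IsHilbert (core₂ hε₁ hε₂ h₁ h₂ hθ) := by
  obtain ⟨C, -, hC⟩ := exists_inner₁_le_norm_sq P
  obtain ⟨D, hD0, hD⟩ := exists_norm_sq_equivL2_le P
  have hθ0 : 0 ≤ θ := (mul_pos hε₁ P.Km_pos).le.trans h₁
  refine isHilbert_of_equiv _ State.equivL2 (C := (1 + θ) * C) (D := D / (1 - θ))
    (fun X => ?_) (fun X => ?_)
  · refine (inner₂_self_le hε₁ hε₂ h₁ h₂ X).trans ?_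
    rw [mul_assoc]
    exact mul_le_mul_of_nonneg_left (hC X) (by linarith)
  · refine (hD X).trans ?_
    have h := inner₂_self_ge hε₁ hε₂ h₁ h₂ X
    change _ ≤ D / (1 - θ) * inner₂ ε₁ ε₂ X X
    rw [div_mul_eq_mul_div, le_div_iff₀ (sub_pos.2 hθ), mul_assoc, mul_comm (inner₁ X X)]
    exact mul_le_mul_of_nonneg_left h hD0.le

/-! ### The domain in terms of primitives -/

theorem InDomain.g_eq {ε₁ ε₂ : ℝ} {X : P.State} (hX : InDomain ε₁ ε₂ X) :
    X.g = volterraSq P.l_pos (wd (wd X.g)) := eq_volterraSq P.l_pos hX.g_mem hX.g_root hX.dg_root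

theorem InDomain.z_eq {ε₁ ε₂ : ℝ} {X : P.State} (hX : InDomain ε₁ ε₂ X) :
    X.z = volterra P.l_pos (wd X.z) := eq_volterra_wd P.l_pos hX.z_mem hX.z_root

/-- Integrating the moment twice from the tip absorbs its two tip conditions. The value g(l) +
ε₁f(l) becomes a pairing with V*1, since (V²u)(l) = ⟪1, Vu⟫. -/
theorem InDomain.bendingMoment_eq {ε₁ ε₂ : ℝ} {X : P.State} (hX : InDomain ε₁ ε₂ X) :
    bendingMoment X = (volterraSq P.l_pos).adjoint (wd (wd (bendingMoment X)))
      - (P.k₁ * ⟪(volterra P.l_pos).adjoint (oneL2 P.l), wd (wd X.g) + ε₁ • X.curv⟫)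
        • (volterra P.l_pos).adjoint (oneL2 P.l) := by
  obtain ⟨fl, gl, h1, h2, h3⟩ := hX.bending_feedback
  have hl : P.l ∈ Icc 0 P.l := right_mem_Icc.2 P.l_pos.le
  rw [X.f_eq] at h1
  rw [hX.g_eq] at h2
  have e1 := h1.unique P.l_pos hl (hasValueAt_volterraSq_right P.l_pos _)
  have e2 := h2.unique P.l_pos hl (hasValueAt_volterraSq_right P.l_pos _)
  rw [inner_add_right, real_inner_smul_right, ← e1, ← e2]
  exact eq_adjoint_volterraSq P.l_pos hX.bending_mem hX.bending_tip h3

/-- One integration from the tip flips the sign of the derivative, so −wd of the moment plays the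
role that the second derivative has in bending. -/
theorem InDomain.torsionMoment_eq {ε₁ ε₂ : ℝ} {X : P.State} (hX : InDomain ε₁ ε₂ X) :
    torsionMoment X = (volterra P.l_pos).adjoint (-wd (torsionMoment X))
      - (P.k₂ * ⟪oneL2 P.l, wd X.z + ε₂ • X.twist⟫) • oneL2 P.l := by
  obtain ⟨hl', zl, h1, h2, h3⟩ := hX.torsion_feedback
  have hl : P.l ∈ Icc 0 P.l := right_mem_Icc.2 P.l_pos.le
  rw [X.h_eq] at h1
  rw [hX.z_eq] at h2
  have e1 := h1.unique P.l_pos hl (hasValueAt_volterra_right P.l_pos _)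
  have e2 := h2.unique P.l_pos hl (hasValueAt_volterra_right P.l_pos _)
  rw [inner_add_right, real_inner_smul_right, ← e1, ← e2, map_neg]
  have h := eq_const_sub_adjoint_wd P.l_pos hX.torsion_mem h3
  nth_rewrite 1 [h]
  rw [neg_smul]
  abel

/-! ### Smallness of the gains and dissipativity -/

/-- The hypothesis is ε < ε* with denominators cleared. Dropping the nonnegative term εAR yields εN
≤ 4, which `damping_estimate` needs. -/
theorem small_gain {ε A R N I : ℝ} (hε : 0 < ε) (hA : 0 ≤ A) (hR : 0 < R) (hI : 0 < I)
    (h : ε * (A * R + N * I / 4) < I) :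
    ε * (R * A) ≤ (1 - ε * N / 4) * I ∧ ε * N ≤ 4 := by
  constructor
  · linarith
  · have h1 : 0 ≤ ε * (A * R) := by positivity
    have h2 : ε * N * I ≤ 4 * I := by linarith
    exact le_of_mul_le_mul_right h2 hI

theorem bending_small_gain {ε : ℝ} (hε : 0 < ε) (h : ε < P.ε₁star) :
    ε * (essSup P.ρ (leb P.l) * (2 * P.l / Real.pi) ^ 4)
      ≤ (1 - ε * essSup P.ηω (leb P.l) / 4) * P.infηEI ∧ ε * essSup P.ηω (leb P.l) ≤ 4 := by
  have hpi := Real.pi_pos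
  have h1 := P.essSup_ρ_pos
  have h2 := P.essSup_ηω_pos
  have h3 := P.infηEI_pos
  have hl := P.l_pos
  refine small_gain hε (by positivity) h1 h3 ?_
  rw [ε₁star, lt_div_iff₀ (by positivity)] at h
  -- The Poincaré constant for two integrations is (2l/π)⁴ = 16l⁴/π⁴; the common denominator 4π⁴
  -- produces the 64 in `ε₁star`.
  have e : ε * ((2 * P.l / Real.pi) ^ 4 * essSup P.ρ (leb P.l)
      + essSup P.ηω (leb P.l) * P.infηEI / 4)
      = ε * (64 * P.l ^ 4 * essSup P.ρ (leb P.l)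
        + Real.pi ^ 4 * essSup P.ηω (leb P.l) * P.infηEI) / (4 * Real.pi ^ 4) := by
    field_simp
    ring
  rw [e, div_lt_iff₀ (by positivity)]
  linarith

theorem torsion_small_gain {ε : ℝ} (hε : 0 < ε) (h : ε < P.ε₂star) :
    ε * (essSup P.Iw (leb P.l) * (2 * P.l / Real.pi) ^ 2)
      ≤ (1 - ε * essSup P.ηφ (leb P.l) / 4) * P.infηGJ ∧ ε * essSup P.ηφ (leb P.l) ≤ 4 := by
  have hpi := Real.pi_pos
  have h1 := P.essSup_Iw_pos
  have h2 := P.essSup_ηφ_pos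
  have h3 := P.infηGJ_pos
  have hl := P.l_pos
  refine small_gain hε (by positivity) h1 h3 ?_
  rw [ε₂star, lt_div_iff₀ (by positivity)] at h
  have e : ε * ((2 * P.l / Real.pi) ^ 2 * essSup P.Iw (leb P.l)
      + essSup P.ηφ (leb P.l) * P.infηGJ / 4)
      = ε * (16 * P.l ^ 2 * essSup P.Iw (leb P.l)
        + Real.pi ^ 2 * essSup P.ηφ (leb P.l) * P.infηGJ) / (4 * Real.pi ^ 2) := by
    field_simp
    ring
  rw [e, div_lt_iff₀ (by positivity)]
  linarith

theorem mulL_neg {l : ℝ} (a : Linf l) (u : L2 l) : mulL a (-u) = -mulL a u :=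
  map_neg (mulOp a) u

/-- The wing operator is dissipative for the modified inner product. -/
theorem inner₂_A₁_nonpos {ε₁ ε₂ : ℝ} (hε₁ : 0 < ε₁) (hε₂ : 0 < ε₂) (h₁ : ε₁ < P.ε₁star)
    (h₂ : ε₂ < P.ε₂star) (X : (P.A₁ ε₁ ε₂).domain) :
    inner₂ ε₁ ε₂ (P.A₁ ε₁ ε₂ X) (X : P.State) ≤ 0 := by
  obtain ⟨X, hXA⟩ := X
  have hX : InDomain ε₁ ε₂ X := hXA
  obtain ⟨b1, b2⟩ := bending_small_gain hε₁ h₁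
  obtain ⟨t1, t2⟩ := torsion_small_gain hε₂ h₂
  have hb := dissipation_estimate (w := X.curv) hε₁ P.k₁_nonneg (ae_nonneg_of_essInf_pos P.EI_pos)
    (ae_le_essSup_Linf P.ηω) (ae_essInf_mul_le_Linf P.ηω P.EI) P.infηEI_pos.le b2
    (ae_le_essSup_Linf P.ρ) P.essSup_ρ_pos.le b1 (norm_sq_volterraSq_le P.l_pos)
    hX.bendingMoment_eq
  have ht := dissipation_estimate (w := X.twist) hε₂ P.k₂_nonneg (ae_nonneg_of_essInf_pos P.GJ_pos)
    (ae_le_essSup_Linf P.ηφ) (ae_essInf_mul_le_Linf P.ηφ P.GJ) P.infηGJ_pos.le t2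
    (ae_le_essSup_Linf P.Iw) P.essSup_Iw_pos.le t1 (norm_sq_volterra_le P.l_pos)
    hX.torsionMoment_eq
  rw [← hX.g_eq, ← X.f_eq] at hb
  rw [← hX.z_eq, ← X.h_eq] at ht
  set Y : P.State := P.A₁ ε₁ ε₂ ⟨X, hXA⟩
  change inner₂ ε₁ ε₂ Y X ≤ 0
  have hf : Y.f = X.g := rfl
  have hcurv : Y.curv = wd (wd X.g) := rfl
  have hg : mulL P.ρ Y.g = -wd (wd (bendingMoment X)) := by
    change mulL P.ρ (-mulL (recip P.ρ P.ρ_pos) (wd (wd (bendingMoment X)))) = _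
    rw [mulL_neg, mulL_mulL_recip _ _ (ae_pos_of_essInf_pos P.ρ_pos)]
  have hh : Y.h = X.z := rfl
  have htwist : Y.twist = wd X.z := rfl
  have hz : mulL P.Iw Y.z = wd (torsionMoment X) :=
    mulL_mulL_recip _ _ (ae_pos_of_essInf_pos P.Iw_pos) _
  rw [inner₂_eq, inner₁_eq, hf, hcurv, hg, hh, htwist, hz]
  simp only [inner_neg_left] at hb ht ⊢
  linarith

/-! ### Solvability of the resolvent equation -/

/-- Converse of `InDomain.bendingMoment_eq` and `InDomain.torsionMoment_eq`: an identity in L²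
already contains the regularity of the moments and the tip conditions, because its right side
consists of primitives taken from the tip. -/
theorem inDomain_mk' {ε₁ ε₂ : ℝ} {w p v q G N : L2 P.l}
    (hM : mulL P.EI w + mulL P.ηω (mulL P.EI p) = (volterraSq P.l_pos).adjoint G
      - (P.k₁ * ⟪(volterra P.l_pos).adjoint (oneL2 P.l), p + ε₁ • w⟫)
        • (volterra P.l_pos).adjoint (oneL2 P.l))
    (hN : mulL P.GJ v + mulL P.ηφ (mulL P.GJ q) = (volterra P.l_pos).adjoint N
      - (P.k₂ * ⟪oneL2 P.l, q + ε₂ • v⟫) • oneL2 P.l) :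
    InDomain ε₁ ε₂ (State.mk' w (volterraSq P.l_pos p) v (volterra P.l_pos q)) ∧
    wd (wd (bendingMoment (State.mk' w (volterraSq P.l_pos p) v (volterra P.l_pos q)))) = G ∧
    wd (torsionMoment (State.mk' w (volterraSq P.l_pos p) v (volterra P.l_pos q))) = -N := by
  set X := State.mk' w (volterraSq P.l_pos p) v (volterra P.l_pos q) with hX
  set c := P.k₁ * ⟪(volterra P.l_pos).adjoint (oneL2 P.l), p + ε₁ • w⟫ with hc
  set d := -(P.k₂ * ⟪oneL2 P.l, q + ε₂ • v⟫) with hd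
  have hf : X.f = volterraSq P.l_pos w := rfl
  have hg : X.g = volterraSq P.l_pos p := rfl
  have hh : X.h = volterra P.l_pos v := rfl
  have hz : X.z = volterra P.l_pos q := rfl
  -- In this nested form the tip value 0, the first derivative c − V*G with tip value c, and the
  -- second derivative G can be read off.
  have hMX : bendingMoment X = (0 : ℝ) • oneL2 P.l
      - (volterra P.l_pos).adjoint (c • oneL2 P.l - (volterra P.l_pos).adjoint G) := by
    rw [bendingMoment, hf, hg, wd_wd_volterraSq, wd_wd_volterraSq, hM, adjoint_volterraSq_apply,
      map_sub, map_smul, zero_smul]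
    abel
  have hNX : torsionMoment X = d • oneL2 P.l - (volterra P.l_pos).adjoint (-N) := by
    rw [torsionMoment, hh, hz, wd_volterra, wd_volterra, hN, map_neg, hd, neg_smul]
    abel
  have hM1 := isWeakDeriv_adjoint_volterra P.l_pos 0
    (c • oneL2 P.l - (volterra P.l_pos).adjoint G)
  have hM2 := isWeakDeriv_adjoint_volterra P.l_pos c G
  have hN1 := isWeakDeriv_adjoint_volterra P.l_pos d (-N)
  rw [← hMX] at hM1
  rw [← hNX] at hN1
  have e1 := hM1.wd_eq
  have vf : HasValueAt X.f P.l _ := hasValueAt_volterraSq_right P.l_pos w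
  have vg : HasValueAt X.g P.l _ := hasValueAt_volterraSq_right P.l_pos p
  have vh : HasValueAt X.h P.l _ := hasValueAt_volterra_right P.l_pos v
  have vz : HasValueAt X.z P.l _ := hasValueAt_volterra_right P.l_pos q
  refine ⟨⟨?_, ?_, ⟨⟨_, hM1⟩, ?_⟩, ⟨_, hN1⟩, ?_, ?_, ?_, ?_, ⟨_, _, vf, vg, ?_⟩,
    ⟨_, _, vh, vz, ?_⟩⟩, ?_, hN1.wd_eq⟩
  · rw [hg]; exact volterraSq_mem_H2 P.l_pos p
  · rw [hz]; exact volterra_mem_H1 P.l_pos q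
  · rw [e1]; exact ⟨_, hM2⟩
  · rw [hg]; exact hasValueAt_volterra_left P.l_pos _
  · rw [hg, volterraSq_apply, wd_volterra]; exact hasValueAt_volterra_left P.l_pos _
  · rw [hz]; exact hasValueAt_volterra_left P.l_pos _
  · rw [hMX]; exact hasValueAt_adjoint_volterra P.l_pos 0 _
  · rw [e1, ← real_inner_smul_right, ← inner_add_right]
    exact hasValueAt_adjoint_volterra P.l_pos c G
  · rw [hNX, ← real_inner_smul_right, ← inner_add_right]
    exact hasValueAt_adjoint_volterra P.l_pos d _
  · rw [e1, hM2.wd_eq]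

/-- The resolvent equation of the wing operator is solvable. -/
theorem exists_resolvent_A₁ {ε₁ ε₂ : ℝ} (hε₁ : 0 < ε₁) (hε₂ : 0 < ε₂) {s : ℝ} (hs : 0 < s)
    (Y : P.State) : ∃ X : (P.A₁ ε₁ ε₂).domain, s • (X : P.State) - P.A₁ ε₁ ε₂ X = Y := by
  obtain ⟨p, hp⟩ := exists_resolvent_solution P.infηEI_pos (ae_nonneg_of_essInf_pos P.EI_pos)
    (ae_nonneg_of_essInf_pos P.ρ_pos) (ae_essInf_mul_le_Linf P.ηω P.EI) (volterraSq P.l_pos)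
    ((volterra P.l_pos).adjoint (oneL2 P.l)) P.k₁_nonneg hε₁ hs Y.curv Y.g
  obtain ⟨q, hq⟩ := exists_resolvent_solution P.infηGJ_pos (ae_nonneg_of_essInf_pos P.GJ_pos)
    (ae_nonneg_of_essInf_pos P.Iw_pos) (ae_essInf_mul_le_Linf P.ηφ P.GJ) (volterra P.l_pos)
    (oneL2 P.l) P.k₂_nonneg hε₂ hs Y.twist Y.z
  obtain ⟨hX, hM, hN⟩ := inDomain_mk' hp hq
  set X := State.mk' (s⁻¹ • (p + Y.curv)) (volterraSq P.l_pos p) (s⁻¹ • (q + Y.twist))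
    (volterra P.l_pos q) with hXdef
  refine ⟨⟨X, hX⟩, ?_⟩
  rw [sub_eq_iff_eq_add]
  refine State.ext' ?_ ?_ ?_ ?_
  · rw [State.curv_smul, State.curv_add]
    change s • X.curv = Y.curv + wd (wd (volterraSq P.l_pos p))
    rw [hXdef, State.curv_mk', wd_wd_volterraSq, smul_inv_smul₀ hs.ne', add_comm]
  · change s • volterraSq P.l_pos p
      = Y.g + -mulL (recip P.ρ P.ρ_pos) (wd (wd (bendingMoment X)))
    rw [hM, mulL_recip_mulL _ _ (ae_pos_of_essInf_pos P.ρ_pos)]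
    abel
  · rw [State.twist_smul, State.twist_add]
    change s • X.twist = Y.twist + wd (volterra P.l_pos q)
    rw [hXdef, State.twist_mk', wd_volterra, smul_inv_smul₀ hs.ne', add_comm]
  · change s • volterra P.l_pos q = Y.z + mulL (recip P.Iw P.Iw_pos) (wd (torsionMoment X))
    rw [hN, mulL_neg, mulL_recip_mulL _ _ (ae_pos_of_essInf_pos P.Iw_pos)]
    abel

end Wing

end

end FlexibleWing

theorem theorem1 (P : FlexibleWing.Wing) (ε₁ ε₂ : ℝ) (hε₁ : 0 < ε₁) (hε₂ : 0 < ε₂)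
    (hε₁' : ε₁ < min P.ε₁star (1 / P.Km)) (hε₂' : ε₂ < min P.ε₂star (1 / P.Km)) :
    ∃ c₁ c₂ : InnerProductSpace.Core ℝ P.State,
      (∀ X Y : P.State, c₁.inner X Y = FlexibleWing.Wing.inner₁ X Y) ∧
      (∀ X Y : P.State, c₂.inner X Y = FlexibleWing.Wing.inner₂ ε₁ ε₂ X Y) ∧
      FlexibleWing.IsHilbert c₁ ∧
      FlexibleWing.IsHilbert c₂ ∧
      FlexibleWing.GeneratesC0ContractionsOn c₂ (P.A₁ ε₁ ε₂) ∧
      FlexibleWing.IsDenseIn c₁ ((P.A₁ ε₁ ε₂).domain : Set P.State) ∧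
      FlexibleWing.IsDenseIn c₂ ((P.A₁ ε₁ ε₂).domain : Set P.State) := by
  have hK := P.Km_pos
  obtain ⟨hs₁, hk₁⟩ := lt_min_iff.1 hε₁'
  obtain ⟨hs₂, hk₂⟩ := lt_min_iff.1 hε₂'
  rw [lt_div_iff₀ hK] at hk₁ hk₂
  -- The larger of the two products serves as the common θ < 1.
  have h₁ : ε₁ * P.Km ≤ max (ε₁ * P.Km) (ε₂ * P.Km) := le_max_left _ _
  have h₂ : ε₂ * P.Km ≤ max (ε₁ * P.Km) (ε₂ * P.Km) := le_max_right _ _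
  have hθ : max (ε₁ * P.Km) (ε₂ * P.Km) < 1 := max_lt hk₁ hk₂
  have hc₂ := FlexibleWing.Wing.isHilbert_core₂ hε₁ hε₂ h₁ h₂ hθ
  have hdis := FlexibleWing.Wing.inner₂_A₁_nonpos hε₁ hε₂ hs₁ hs₂
  have hres := fun s (hs : 0 < s) Y =>
    FlexibleWing.Wing.exists_resolvent_A₁ (P := P) hε₁ hε₂ (s := s) hs Y
  have hdense := FlexibleWing.isDenseIn_domain_of_dissipative _ hc₂ hdis
    fun Y => by simpa using hres 1 one_pos Y
  refine ⟨P.core₁, FlexibleWing.Wing.core₂ hε₁ hε₂ h₁ h₂ hθ, fun _ _ => rfl, fun _ _ => rfl,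
    FlexibleWing.Wing.isHilbert_core₁, hc₂,
    FlexibleWing.generatesC0ContractionsOn_of_dissipative _ hc₂ hdis hres,
    -- Density passes to the energy norm through inner₁ ≤ (1 − θ)⁻¹ inner₂ on the diagonal.
    hdense.of_le (inv_pos.2 (sub_pos.2 hθ)) fun X => ?_, hdense⟩
  rw [inv_mul_eq_div, le_div_iff₀' (sub_pos.2 hθ)]
  exact FlexibleWing.Wing.inner₂_self_ge hε₁ hε₂ h₁ h₂ X
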